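/- A halfspace over $\mathbb{R}^n$ is a function $h:\mathbb{R}^n\to\{0,1\}$ with $h(x)=1$ if $w_0+\sum_{i=1}^n w_ix_i\ge 0$ and $h(x)=0$ otherwise, where $w_0,\dots,w_n\in\mathbb{R}$. Let $\mathcal{L}_n^{\cap k}$ be the class of all functions $h_1\wedge\cdots\wedge h_k$ where each $h_j$ is a halfspace over $\mathbb{R}^n$. For a probability distribution $\mathcal{D}$ on the Lebesgue measurable sets of $\mathbb{R}^n$, a class $\mathcal{H}$ of functions $\mathbb{R}^n\to\{0,1\}$ and a measurable $f:\mathbb{R}^n\to\{0,1\}$, let $\mathrm{dist}_{\mathcal{D}}(f,\mathcal{H})=\inf_{h\in\mathcal{H}}\Pr_{x\sim\mathcal{D}}[f(x)\ne h(x)]$. Let $m^{\mathrm{test}}_\epsilon(\mathcal{H})$ be the least $m$ for which there is a randomized algorithm that receives $m$ independent labelled examples $(x,f(x))$, $x\sim\mathcal{D}$, and, for every (unknown) $\mathcal{D}$ and $f$, outputs $1$ with probability at least $2/3$ if $f\in\mathcal{H}$ and outputs $0$ with probability at least $2/3$ if $\mathrm{dist}_{\mathcal{D}}(f,\mathcal{H})>\epsilon$.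 Let $q^{\mathrm{tol}}_{\epsilon_1,\epsilon_2}(\mathcal{H})$, for $0\le\epsilon_1<\epsilon_2$, be the least $q$ for which there is a randomized adaptive algorithm that obtains at most $q$ values of $f$ in total, each either as a fresh random example $(x,f(x))$ with $x\sim\mathcal{D}$ or as the answer $f(x)$ to a query $x\in\mathbb{R}^n$ of its choice, and that, for every $\mathcal{D}$ and $f$, outputs $1$ with probability at least $2/3$ if $\mathrm{dist}_{\mathcal{D}}(f,\mathcal{H})\le\epsilon_1$ and outputs $0$ with probability at least $2/3$ if $\mathrm{dist}_{\mathcal{D}}(f,\mathcal{H})\ge\epsilon_2$. **Theorem.** There are absolute constants $\epsilon_0>0$ and $c>0$ such that for all $0<\epsilon<\epsilon_0$ and all integers $n\ge 2$, $k\ge 1$, $$m^{\mathrm{test}}_\epsilon(\mathcal{L}_n^{\cap k})\ \ge\ c\,\frac{nk}{\log(nk)}\qquad\text{and}\qquad q^{\mathrm{tol}}_{0,\epsilon}(\mathcal{L}_n^{\cap k})\ \ge\ c\,\frac{nk}{\log(nk)}.$$ -/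

import Mathlib

open MeasureTheory
open scoped ENNReal

namespace PropertyTesting

section General

variable {X : Type*} [MeasurableSpace X]

/-- `dist_D(f, H) = inf_{h ∈ H} Pr_{x ∼ D} [f x ≠ h x]`. -/
noncomputable def distToClass (D : Measure X) (f : X → Bool) (H : Set (X → Bool)) : ℝ≥0∞ :=
  ⨅ h ∈ H, D {x | f x ≠ h x}

/-- A randomized algorithm that receives `m` labelled examples and outputs a bit. Its internal
randomness is a seed drawn, independently of the examples, from a probability space of its own. -/
structure SampleAlgorithm (X : Type*) [MeasurableSpace X] (m : ℕ) where
  Seed : Type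
  [seedSpace : MeasurableSpace Seed]
  seedLaw : Measure Seed
  [seedLaw_prob : IsProbabilityMeasure seedLaw]
  output : Seed → (Fin m → X × Bool) → Bool
  measurable_output :
    Measurable fun p : Seed × (Fin m → X × Bool) => output p.1 p.2

attribute [instance] SampleAlgorithm.seedSpace SampleAlgorithm.seedLaw_prob

/-- The probability that `A` outputs `b` on `m` independent examples `(x, f x)` with `x ∼ D`. -/
noncomputable def SampleAlgorithm.outputProb {m : ℕ} (A : SampleAlgorithm X m)
    (D : Measure X) (f : X → Bool) (b : Bool) : ℝ≥0∞ :=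
  (A.seedLaw.prod (Measure.pi fun _ : Fin m => D))
    {p | A.output p.1 (fun i => (p.2 i, f (p.2 i))) = b}

/-- `A` is a (two-sided) distribution-free sample `ε`-tester for `H`. -/
def SampleAlgorithm.IsTester {m : ℕ} (A : SampleAlgorithm X m) (H : Set (X → Bool)) (ε : ℝ) :
    Prop :=
  ∀ (D : Measure X) [IsProbabilityMeasure D] (f : X → Bool), Measurable f →
    (f ∈ H → 2 / 3 ≤ A.outputProb D f true) ∧
    (ENNReal.ofReal ε < distToClass D f H → 2 / 3 ≤ A.outputProb D f false)

/-- The least `m` for which a distribution-free sample `ε`-tester for `H` with `m` samples exists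
(`⊤` if there is none). -/
noncomputable def sampleComplexity (H : Set (X → Bool)) (ε : ℝ) : ℕ∞ :=
  ⨅ (m : ℕ) (_ : ∃ A : SampleAlgorithm X m, A.IsTester H ε), (m : ℕ∞)

/-- A randomized adaptive algorithm that obtains `q` labelled points. In step `i`, depending on its
seed and on the `i` labelled points obtained so far, it either asks for a fresh sample
(`Sum.inl ()`) or queries a point `x` of its choice (`Sum.inr x`). An algorithm that needs
fewer than `q` labels may ignore the superfluous ones. -/
structure QueryAlgorithm (X : Type*) [MeasurableSpace X] (q : ℕ) where
  Seed : Type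
  [seedSpace : MeasurableSpace Seed]
  seedLaw : Measure Seed
  [seedLaw_prob : IsProbabilityMeasure seedLaw]
  next : (i : ℕ) → Seed → (Fin i → X × Bool) → Unit ⊕ X
  measurable_next : ∀ i, Measurable fun p : Seed × (Fin i → X × Bool) => next i p.1 p.2
  output : Seed → (Fin q → X × Bool) → Bool
  measurable_output :
    Measurable fun p : Seed × (Fin q → X × Bool) => output p.1 p.2

attribute [instance] QueryAlgorithm.seedSpace QueryAlgorithm.seedLaw_prob

/-- The labelled points that `A` obtains in its first `i` steps on the function `f` with seed `ω`;
`s j` is the sample that it gets in step `j` if it asks for a sample in that step. -/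
def QueryAlgorithm.transcript {q : ℕ} (A : QueryAlgorithm X q) (f : X → Bool) (ω : A.Seed) :
    (i : ℕ) → (Fin i → X) → (Fin i → X × Bool)
  | 0, _ => Fin.elim0
  | i + 1, s =>
    let past : Fin i → X × Bool := A.transcript f ω i (Fin.init s)
    let x : X := Sum.elim (fun _ => s (Fin.last i)) id (A.next i ω past)
    Fin.snoc (α := fun _ => X × Bool) past (x, f x)

/-- The probability that `A` outputs `b` on the function `f` and the distribution `D`. -/
noncomputable def QueryAlgorithm.outputProb {q : ℕ} (A : QueryAlgorithm X q)
    (D : Measure X) (f : X → Bool) (b : Bool) : ℝ≥0∞ :=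
  (A.seedLaw.prod (Measure.pi fun _ : Fin q => D))
    {p | A.output p.1 (A.transcript f p.1 q p.2) = b}

/-- `A` is an `(ε₁, ε₂)`-tolerant distribution-free adaptive tester for `H`. -/
def QueryAlgorithm.IsTolerantTester {q : ℕ} (A : QueryAlgorithm X q) (H : Set (X → Bool))
    (ε₁ ε₂ : ℝ) : Prop :=
  ∀ (D : Measure X) [IsProbabilityMeasure D] (f : X → Bool), Measurable f →
    (distToClass D f H ≤ ENNReal.ofReal ε₁ → 2 / 3 ≤ A.outputProb D f true) ∧
    (ENNReal.ofReal ε₂ ≤ distToClass D f H → 2 / 3 ≤ A.outputProb D f false)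

/-- The least `q` for which an `(ε₁, ε₂)`-tolerant distribution-free adaptive tester for `H` exists
that obtains `q` labels in total, by samples and queries (`⊤` if there is none). -/
noncomputable def tolerantQueryComplexity (H : Set (X → Bool)) (ε₁ ε₂ : ℝ) : ℕ∞ :=
  ⨅ (q : ℕ) (_ : ∃ A : QueryAlgorithm X q, A.IsTolerantTester H ε₁ ε₂), (q : ℕ∞)

end General

/-- `ℝⁿ` with the `σ`-algebra of Lebesgue measurable sets. -/
abbrev LebesgueSpace (n : ℕ) : Type :=
  NullMeasurableSpace (Fin n → ℝ) volume

/-- The halfspace `x ↦ sign (w₀ + ∑ i, w i * x i)`, with `true` for a sum that is `≥ 0` and `false`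
for a negative one. -/
noncomputable def halfspace {n : ℕ} (w₀ : ℝ) (w : Fin n → ℝ) : LebesgueSpace n → Bool :=
  fun x : Fin n → ℝ => decide (0 ≤ w₀ + ∑ i, w i * x i)

/-- The class of all functions `h₁ ∧ h₂ ∧ ⋯ ∧ h_k` where each `h_j` is a halfspace over `ℝⁿ`. -/
def halfspaceIntersections (n k : ℕ) : Set (LebesgueSpace n → Bool) :=
  {f | ∃ (w₀ : Fin k → ℝ) (w : Fin k → Fin n → ℝ),
    ∀ x, f x = true ↔ ∀ j, halfspace (w₀ j) (w j) x = true}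

end PropertyTesting

/-! Testing intersections of halfspaces is at least as hard as deciding whether an unknown
distribution on `N = 2nk` symbols has small support, and the latter needs of order `N / log N`
samples.

Geometry. On the moment curve a halfspace is the nonnegativity set of a polynomial of degree at most
`n`. Symbol `i` becomes a pair of neighbouring points on the curve, labelled `false` and `true`,
which share its mass equally. If at most `k * (n / 2)` symbols carry mass, squared linear factors
cut off all their `false` points, so the labelling agrees almost everywhere with a member of the
class (`exists_agreeing_halfspaceIntersection`). Conversely, `k` polynomials of degree `n` separate
at most `nk` pairs, by counting roots. If every symbol has mass at least `1 / (140 N)`, the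
remaining `nk` pairs force distance at least `1 / 560` (`le_distToClass_pairMeasure`). The labelling
is fixed in advance, so neither labels nor queries reveal anything beyond the sampled symbols.

Statistics. `exists_moment_matching` gives two laws with equal moments up to order `J + 1`, one
almost concentrated at `0`, the other supported in `[1, O(J²)]`. Take independent weights `u i` from
one of them and let the distribution be proportional to `u`. Samples are produced by rejection:
propose uniform symbols and accept `i` with probability `u i / l`. For a fixed sequence of proposals
the expected verdict is a polynomial in `u` whose degree in each variable is at most the number of
times that symbol is proposed. With `J` of order `log N` and `m` of order `N log N` proposals,
rarely is any symbol proposed more than `J + 1` times, so both laws give almost the same verdict,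
although about `m / J²`, that is `N / log N`, samples are accepted. -/

/-! ### Two laws with matching moments. -/

/-- The nodal weights of a finite set of reals containing `0`, scaled to have weight `1` at `0`. -/
noncomputable def relNodalWeight (s : Finset ℝ) (y : ℝ) : ℝ :=
  (∏ z ∈ s.erase 0, (0 - z)) / ∏ z ∈ s.erase y, (y - z)

lemma relNodalWeight_zero (s : Finset ℝ) : relNodalWeight s 0 = 1 := by
  unfold relNodalWeight
  refine div_self (Finset.prod_ne_zero_iff.2 fun z hz => ?_)
  rw [Finset.mem_erase] at hz
  simpa using hz.1

/-- Up to scaling, the sum is the coefficient of degree `s.card - 1` in the Lagrange interpolant of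
`X ^ j`, which is `X ^ j` itself. -/
lemma sum_relNodalWeight_mul_pow (s : Finset ℝ) (j : ℕ) (hj : j + 1 < s.card) :
    ∑ y ∈ s, relNodalWeight s y * y ^ j = 0 := by
  have h := Lagrange.coeff_eq_sum (s := s) (v := fun y : ℝ => y) (fun _ _ _ _ h => h)
    (P := (Polynomial.X : Polynomial ℝ) ^ j) (by
      rw [Polynomial.degree_X_pow]; exact_mod_cast (by omega : j < s.card))
  rw [Polynomial.coeff_X_pow, if_neg (by omega)] at h
  have h2 : ∑ y ∈ s, relNodalWeight s y * y ^ j = (∏ z ∈ s.erase 0, (0 - z)) *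
      ∑ y ∈ s, (Polynomial.X ^ j : Polynomial ℝ).eval y / ∏ z ∈ s.erase y, (y - z) := by
    rw [Finset.mul_sum]
    refine Finset.sum_congr rfl fun y _ => ?_
    simp only [relNodalWeight, Polynomial.eval_pow, Polynomial.eval_X]
    ring
  rw [h2, ← h, mul_zero]

lemma abs_relNodalWeight {s : Finset ℝ} (h0 : (0 : ℝ) ∈ s) {y : ℝ} (hy : y ∈ s) (hy0 : y ≠ 0) :
    |relNodalWeight s y| = ∏ z ∈ (s.erase 0).erase y, |z / (z - y)| := by
  unfold relNodalWeight
  have h1 : ∏ z ∈ s.erase 0, (0 - z) = (0 - y) * ∏ z ∈ (s.erase 0).erase y, (0 - z) :=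
    (Finset.mul_prod_erase _ _ (Finset.mem_erase.2 ⟨hy0, hy⟩)).symm
  have h2 : ∏ z ∈ s.erase y, (y - z) = (y - 0) * ∏ z ∈ (s.erase 0).erase y, (y - z) := by
    rw [Finset.erase_right_comm]
    exact (Finset.mul_prod_erase _ (fun z => y - z) (Finset.mem_erase.2 ⟨hy0.symm, h0⟩)).symm
  rw [h1, h2, ← Finset.abs_prod, Finset.prod_div_distrib, abs_div, abs_mul, abs_mul, abs_div]
  have h3 : |∏ z ∈ (s.erase 0).erase y, (0 - z)| = |∏ z ∈ (s.erase 0).erase y, z| := by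
    simp only [Finset.abs_prod, zero_sub, abs_neg]
  have h4 : |∏ z ∈ (s.erase 0).erase y, (y - z)| = |∏ z ∈ (s.erase 0).erase y, (z - y)| := by
    simp only [Finset.abs_prod]
    exact Finset.prod_congr rfl fun z _ => abs_sub_comm _ _
  rw [h3, h4, zero_sub, abs_neg, sub_zero, mul_div_mul_left _ _ (abs_ne_zero.2 hy0)]

/-- Splitting a signed measure of total mass zero with an atom of mass one at `0` into two
probability measures. -/
lemma exists_laws_of_signed (s : Finset ℝ) (W : ℝ → ℝ) (L : ℕ) (h0 : (0 : ℝ) ∈ s)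
    (h1 : (1 : ℝ) ∈ s) (hs : ∀ y ∈ s, 0 ≤ y) (W0 : W 0 = 1)
    (hL : 1 ≤ L) (hmom : ∀ j ≤ L, ∑ y ∈ s, W y * y ^ j = 0) {η μ : ℝ}
    (hη : ∑ y ∈ (s.erase 0).erase 1, |W y| ≤ η) (hη1 : η ≤ 1)
    (hμ : ∑ y ∈ (s.erase 0).erase 1, |W y| * y ≤ μ) :
    ∃ P Q : ℝ → ℝ, (∀ y, 0 ≤ P y) ∧ (∀ y, 0 ≤ Q y) ∧ ∑ y ∈ s, P y = 1 ∧ ∑ y ∈ s, Q y = 1 ∧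
      (∀ j ≤ L, ∑ y ∈ s, P y * y ^ j = ∑ y ∈ s, Q y * y ^ j) ∧ Q 0 = 0 ∧
      ∑ y ∈ s.erase 0, P y ≤ η ∧ ∑ y ∈ s, Q y * y ≤ μ := by
  classical
  have split : ∀ g : ℝ → ℝ, ∑ y ∈ s, g y = g 0 + (g 1 + ∑ y ∈ (s.erase 0).erase 1, g y) := by
    intro g
    rw [Finset.add_sum_erase _ _ (Finset.mem_erase.2 ⟨one_ne_zero, h1⟩),
      Finset.add_sum_erase _ _ h0]
  -- The total mass is zero, the atom at `0` has mass one and the other nodes carry at most `η ≤ 1`,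
  -- so `1` belongs to the negative part.
  have W1 : W 1 ≤ 0 := by
    have h := hmom 0 (Nat.zero_le _)
    rw [split] at h
    simp only [mul_one, pow_zero] at h
    have e : -∑ y ∈ (s.erase 0).erase 1, W y ≤ ∑ y ∈ (s.erase 0).erase 1, |W y| := by
      rw [← Finset.sum_neg_distrib]
      exact Finset.sum_le_sum fun y _ => neg_le_abs _
    linarith
  set Z := ∑ y ∈ s, max (W y) 0 with hZ
  have hmm : ∀ y, max (W y) 0 = max (-W y) 0 + W y := by
    intro y
    rcases le_total (W y) 0 with h | h
    · rw [max_eq_right h, max_eq_left (by linarith)]; ring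
    · rw [max_eq_left h, max_eq_right (by linarith)]; ring
  have hmomZ : ∀ j ≤ L, ∑ y ∈ s, max (W y) 0 * y ^ j = ∑ y ∈ s, max (-W y) 0 * y ^ j := by
    intro j hj
    have h := hmom j hj
    have : ∑ y ∈ s, max (W y) 0 * y ^ j
        = ∑ y ∈ s, max (-W y) 0 * y ^ j + ∑ y ∈ s, W y * y ^ j := by
      rw [← Finset.sum_add_distrib]
      refine Finset.sum_congr rfl fun y _ => ?_
      rw [hmm y]; ring
    rw [this, h, add_zero]
  have hZ' : Z = ∑ y ∈ s, max (-W y) 0 := by simpa using hmomZ 0 (Nat.zero_le _)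
  have hZ1 : 1 ≤ Z := by
    rw [hZ, split, W0]
    have : 0 ≤ ∑ y ∈ (s.erase 0).erase 1, max (W y) 0 :=
      Finset.sum_nonneg fun y _ => le_max_right _ _
    have h2 : (0 : ℝ) ≤ max (W 1) 0 := le_max_right _ _
    have h3 : (1 : ℝ) ≤ max 1 0 := le_max_left _ _
    linarith
  have hZ0 : 0 < Z := by linarith
  have hle : ∀ y, max (W y) 0 ≤ |W y| := fun y => max_le (le_abs_self _) (abs_nonneg _)
  have hmomP : ∀ j ≤ L, ∑ y ∈ s, max (W y) 0 / Z * y ^ j = ∑ y ∈ s, max (-W y) 0 / Z * y ^ j := by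
    intro j hj
    simp only [div_mul_eq_mul_div, ← Finset.sum_div]
    rw [hmomZ j hj]
  refine ⟨fun y => max (W y) 0 / Z, fun y => max (-W y) 0 / Z, fun y => by positivity,
    fun y => by positivity, ?_, ?_, hmomP, ?_, ?_, ?_⟩
  · rw [← Finset.sum_div]; exact div_self hZ0.ne'
  · rw [← Finset.sum_div, ← hZ']; exact div_self hZ0.ne'
  · simp [W0]
  · rw [← Finset.add_sum_erase _ _ (Finset.mem_erase.2 ⟨one_ne_zero, h1⟩), max_eq_right W1, zero_div,
      zero_add]
    refine le_trans (Finset.sum_le_sum fun y _ => ?_) hη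
    exact (div_le_self (le_max_right _ _) hZ1).trans (hle y)
  -- The first moment of `Q` equals that of `P`, which puts no mass at `1`; hence the large atom of
  -- `W` at `1` does not enter the bound.
  · have h := hmomP 1 hL
    simp only [pow_one] at h
    rw [← h, split]
    simp only [mul_zero, max_eq_right W1, zero_div, zero_mul, zero_add]
    refine le_trans (Finset.sum_le_sum fun y hy => ?_) hμ
    have hy' : 0 ≤ y := hs y (Finset.mem_of_mem_erase (Finset.mem_of_mem_erase hy))
    exact mul_le_mul_of_nonneg_right ((div_le_self (le_max_right _ _) hZ1).trans (hle y)) hy'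

/-- Factoring `i² - j² = (i - j)(i + j)` produces factorials. With `J = j + d` the value is twice
the ratio of the binomial coefficients `(2J choose d)` and `(2J choose J)`. -/
lemma prod_abs_sq_div_sub_sq_eq (j : ℕ) (hj : 1 ≤ j) (d : ℕ) :
    ∏ i ∈ (Finset.Icc 1 (j + d)).erase j, |(i : ℝ) ^ 2 / ((i : ℝ) ^ 2 - (j : ℝ) ^ 2)| =
      2 * ((j + d).factorial : ℝ) ^ 2 / (d.factorial * (j + d + j).factorial) := by
  induction d with
  | zero =>
    obtain ⟨r, rfl⟩ : ∃ r, j = r + 1 := ⟨j - 1, by omega⟩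
    have e : (Finset.Icc 1 (r + 1 + 0)).erase (r + 1) = Finset.Icc 1 r := by
      ext x; simp only [Finset.mem_erase, Finset.mem_Icc]; omega
    have h1 : ∀ r : ℕ, ∏ i ∈ Finset.Icc 1 r, (i : ℝ) = r.factorial := by
      intro r
      induction r with
      | zero => simp
      | succ r ih => rw [Finset.prod_Icc_succ_top (by omega), ih, Nat.factorial_succ]; push_cast; ring
    have h2 : ∏ i ∈ Finset.Icc 1 r, ((r : ℝ) + 1 - i) = r.factorial := by
      rw [← h1 r]
      refine Finset.prod_bij' (fun i _ => r + 1 - i) (fun i _ => r + 1 - i) ?_ ?_ ?_ ?_ ?_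
      · intro i hi; simp only [Finset.mem_Icc] at *; omega
      · intro i hi; simp only [Finset.mem_Icc] at *; omega
      · intro i hi; simp only [Finset.mem_Icc] at *; omega
      · intro i hi; simp only [Finset.mem_Icc] at *; omega
      · intro i hi
        simp only [Finset.mem_Icc] at hi
        rw [Nat.cast_sub (by omega)]; push_cast; ring
    have h3 : ∀ t : ℕ, (∏ i ∈ Finset.Icc 1 t, ((r : ℝ) + 1 + i)) * (r + 1).factorial
        = (r + 1 + t).factorial := by
      intro t
      induction t with
      | zero => simp
      | succ t ih =>
        rw [Finset.prod_Icc_succ_top (by omega), mul_right_comm, ih, ← add_assoc,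
          Nat.factorial_succ (r + 1 + t)]
        push_cast; ring
    rw [e]
    have h4 : ∏ i ∈ Finset.Icc 1 r, |(i : ℝ) ^ 2 / ((i : ℝ) ^ 2 - ((r + 1 : ℕ) : ℝ) ^ 2)| =
        (∏ i ∈ Finset.Icc 1 r, (i : ℝ)) ^ 2 / ((∏ i ∈ Finset.Icc 1 r, ((r : ℝ) + 1 - i)) *
          ∏ i ∈ Finset.Icc 1 r, ((r : ℝ) + 1 + i)) := by
      rw [← Finset.prod_pow, ← Finset.prod_mul_distrib, ← Finset.prod_div_distrib]
      refine Finset.prod_congr rfl fun i hi => ?_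
      simp only [Finset.mem_Icc] at hi
      have hi' : (i : ℝ) ≤ r := by exact_mod_cast hi.2
      have hpos : 0 < ((r : ℝ) + 1 - i) * (r + 1 + i) := by
        apply mul_pos
        · linarith
        · positivity
      rw [abs_div, abs_of_nonneg (by positivity : (0 : ℝ) ≤ (i : ℝ) ^ 2), abs_of_neg]
      · congr 1; push_cast; ring
      · push_cast; nlinarith
    rw [h4, h1, h2]
    have h5 := h3 r
    have h6 : ((r + 1 : ℕ).factorial : ℝ) = (r + 1) * r.factorial := by
      rw [Nat.factorial_succ]; push_cast; ring
    have h7 : ((r + 1 + 0 + (r + 1)).factorial : ℝ) = 2 * (r + 1) * (r + 1 + r).factorial := by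
      rw [show r + 1 + 0 + (r + 1) = r + 1 + r + 1 by ring, Nat.factorial_succ]; push_cast; ring
    have hf : (0 : ℝ) < r.factorial := by exact_mod_cast r.factorial_pos
    have hA : 0 < ∏ i ∈ Finset.Icc 1 r, ((r : ℝ) + 1 + i) :=
      Finset.prod_pos fun i _ => by positivity
    rw [h7, ← h5, add_zero, h6, Nat.factorial_zero, Nat.cast_one]
    field_simp
  | succ d ih =>
    have e : (Finset.Icc 1 (j + (d + 1))).erase j
        = insert (j + d + 1) ((Finset.Icc 1 (j + d)).erase j) := by
      ext x; simp only [Finset.mem_erase, Finset.mem_Icc, Finset.mem_insert]; omega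
    rw [e, Finset.prod_insert (by simp), ih]
    have h1 : ((j + (d + 1)).factorial : ℝ) = (j + d + 1) * (j + d).factorial := by
      rw [← add_assoc, Nat.factorial_succ]; push_cast; ring
    have h2 : ((d + 1).factorial : ℝ) = (d + 1) * d.factorial := by
      rw [Nat.factorial_succ]; push_cast; ring
    have h3 : ((j + (d + 1) + j).factorial : ℝ) = (j + d + j + 1) * (j + d + j).factorial := by
      rw [show j + (d + 1) + j = j + d + j + 1 by ring, Nat.factorial_succ]; push_cast; ring
    have h4 : (((j + d + 1 : ℕ) : ℝ) ^ 2 - (j : ℝ) ^ 2) = (d + 1) * (j + d + j + 1) := by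
      push_cast; ring
    have hf1 : (0 : ℝ) < d.factorial := by exact_mod_cast d.factorial_pos
    have hf2 : (0 : ℝ) < (j + d + j).factorial := by exact_mod_cast (j + d + j).factorial_pos
    rw [h1, h2, h3, h4, abs_of_nonneg (by positivity)]
    push_cast
    field_simp

/-- The central binomial coefficient is the largest in its row, so the ratio in the closed form is
at most one. -/
lemma prod_abs_sq_div_sub_sq_le {j J : ℕ} (hj : 1 ≤ j) (hJ : j ≤ J) :
    ∏ i ∈ (Finset.Icc 1 J).erase j, |(i : ℝ) ^ 2 / ((i : ℝ) ^ 2 - (j : ℝ) ^ 2)| ≤ 2 := by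
  obtain ⟨d, rfl⟩ := Nat.exists_eq_add_of_le hJ
  rw [prod_abs_sq_div_sub_sq_eq j hj d]
  have hf1 : (0 : ℝ) < d.factorial := by exact_mod_cast d.factorial_pos
  have hf2 : (0 : ℝ) < (j + d + j).factorial := by exact_mod_cast (j + d + j).factorial_pos
  rw [div_le_iff₀ (by positivity)]
  have h := Nat.choose_le_centralBinom d (j + d)
  rw [Nat.centralBinom] at h
  have h1 := Nat.choose_mul_factorial_mul_factorial (show d ≤ 2 * (j + d) by omega)
  have h2 := Nat.choose_mul_factorial_mul_factorial (show j + d ≤ 2 * (j + d) by omega)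
  rw [show 2 * (j + d) - d = j + d + j by omega] at h1
  rw [show 2 * (j + d) - (j + d) = j + d by omega] at h2
  have hc : 0 < (2 * (j + d)).choose d := Nat.choose_pos (by omega)
  have key : (j + d).factorial * (j + d).factorial ≤ d.factorial * (j + d + j).factorial := by
    by_contra hlt
    push Not at hlt
    have h3 : (2 * (j + d)).choose d * (d.factorial * (j + d + j).factorial)
        < (2 * (j + d)).choose (j + d) * ((j + d).factorial * (j + d).factorial) :=
      lt_of_lt_of_le (Nat.mul_lt_mul_of_pos_left hlt hc) (Nat.mul_le_mul_right _ h)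
    rw [← mul_assoc, ← mul_assoc, h1, h2] at h3
    exact lt_irrefl _ h3
  have key' : ((j + d).factorial : ℝ) * (j + d).factorial ≤ d.factorial * (j + d + j).factorial := by
    exact_mod_cast key
  nlinarith

lemma one_sub_sum_le_prod_one_sub {ι : Type*} (s : Finset ι) (a : ι → ℝ)
    (h0 : ∀ i ∈ s, 0 ≤ a i) (h1 : ∀ i ∈ s, a i ≤ 1) :
    1 - ∑ i ∈ s, a i ≤ ∏ i ∈ s, (1 - a i) := by
  classical
  induction s using Finset.induction_on with
  | empty => simp
  | insert i s hi ih =>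
    rw [Finset.sum_insert hi, Finset.prod_insert hi]
    have ih' := ih (fun k hk => h0 k (Finset.mem_insert_of_mem hk))
      (fun k hk => h1 k (Finset.mem_insert_of_mem hk))
    have a0 := h0 i (Finset.mem_insert_self _ _)
    have a1 := h1 i (Finset.mem_insert_self _ _)
    have s0 : 0 ≤ ∑ k ∈ s, a k := Finset.sum_nonneg fun k hk =>
      h0 k (Finset.mem_insert_of_mem hk)
    nlinarith

lemma sum_inv_sq_le_two (J : ℕ) : ∑ j ∈ Finset.Icc 1 J, 1 / (j : ℝ) ^ 2 ≤ 2 := by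
  -- The strengthened bound telescopes. At `J = 0` it reads `0 ≤ 2` because `1 / 0 = 0`, so the step
  -- to `J = 1` is separate.
  have h : ∑ j ∈ Finset.Icc 1 J, 1 / (j : ℝ) ^ 2 ≤ 2 - 1 / (J : ℝ) := by
    induction J with
    | zero => norm_num
    | succ J ih =>
      rw [Finset.sum_Icc_succ_top (by omega)]
      rcases Nat.eq_zero_or_pos J with rfl | hJ
      · norm_num
      · have hJ' : (0 : ℝ) < J := by exact_mod_cast hJ
        have e : 1 / (J : ℝ) - 1 / (J + 1) = 1 / (J * (J + 1)) := by field_simp; ring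
        have : (1 : ℝ) / (J + 1) ^ 2 ≤ 1 / (J * (J + 1)) :=
          one_div_le_one_div_of_le (by positivity) (by nlinarith)
        push_cast
        linarith
  have : (0 : ℝ) ≤ 1 / (J : ℝ) := by positivity
  linarith

/-- Two laws on `{0} ∪ [1, 4000 J²]` with equal moments up to order `J + 1`: the first is almost
entirely concentrated at `0`, the second gives no mass to `0`. -/
theorem exists_moment_matching (J : ℕ) (hJ : 1 ≤ J) :
    ∃ (s : Finset ℝ) (P Q : ℝ → ℝ), (∀ y ∈ s, y = 0 ∨ (1 ≤ y ∧ y ≤ 4000 * (J : ℝ) ^ 2)) ∧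
      (0 : ℝ) ∈ s ∧ (∀ y, 0 ≤ P y) ∧ (∀ y, 0 ≤ Q y) ∧ ∑ y ∈ s, P y = 1 ∧ ∑ y ∈ s, Q y = 1 ∧
      (∀ j ≤ J + 1, ∑ y ∈ s, P y * y ^ j = ∑ y ∈ s, Q y * y ^ j) ∧ Q 0 = 0 ∧
      ∑ y ∈ s.erase 0, P y ≤ 1 / 200 ∧ ∑ y ∈ s, Q y * y ≤ 7 := by
  classical
  set g : ℕ → ℝ := fun j => 4000 * (j : ℝ) ^ 2 with hg
  have g_inj : Function.Injective g := by
    intro i j h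
    simp only [hg] at h
    have h' : (i : ℝ) ^ 2 = (j : ℝ) ^ 2 := by linarith
    have := (sq_eq_sq₀ (Nat.cast_nonneg i) (Nat.cast_nonneg j)).1 h'
    exact_mod_cast this
  set T : Finset ℝ := (Finset.Icc 1 J).image g with hT
  have g_ge : ∀ j ∈ Finset.Icc 1 J, (4000 : ℝ) ≤ g j := by
    intro j hj
    have : (1 : ℝ) ≤ j := by exact_mod_cast (Finset.mem_Icc.1 hj).1
    simp only [hg]; nlinarith
  have T_ge : ∀ y ∈ T, (4000 : ℝ) ≤ y := by
    intro y hy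
    obtain ⟨j, hj, rfl⟩ := Finset.mem_image.1 hy
    exact g_ge j hj
  have nT : ∀ y : ℝ, y < 4000 → y ∉ T := fun y hy h => absurd (T_ge y h) (not_le.2 hy)
  have c1 : (1000 : ℝ) ∉ T := nT _ (by norm_num)
  have c2 : (1 : ℝ) ∉ insert (1000 : ℝ) T := by
    rw [Finset.mem_insert, not_or]; exact ⟨by norm_num, nT _ (by norm_num)⟩
  have c3 : (0 : ℝ) ∉ insert (1 : ℝ) (insert (1000 : ℝ) T) := by
    rw [Finset.mem_insert, Finset.mem_insert, not_or, not_or]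
    exact ⟨by norm_num, by norm_num, nT _ (by norm_num)⟩
  -- Quadratically spaced nodes keep the weights bounded while the range is only `O(J²)`. Node `1`
  -- absorbs most of the mass opposite to the atom at `0`. Node `1000` contributes an extra factor
  -- of order `1 / y` to the weight at a grid node `y`, which makes the first moment summable
  -- uniformly in `J`.
  set s : Finset ℝ := insert 0 (insert 1 (insert 1000 T)) with hs
  have e0 : s.erase 0 = insert 1 (insert 1000 T) := Finset.erase_insert c3
  have e1 : (s.erase 0).erase 1 = insert 1000 T := by rw [e0]; exact Finset.erase_insert c2
  have hcard : s.card = J + 3 := by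
    rw [hs, Finset.card_insert_of_notMem c3, Finset.card_insert_of_notMem c2,
      Finset.card_insert_of_notMem c1, hT, Finset.card_image_of_injective _ g_inj]
    simp
  have h0s : (0 : ℝ) ∈ s := Finset.mem_insert_self _ _
  have h1s : (1 : ℝ) ∈ s := Finset.mem_insert_of_mem (Finset.mem_insert_self _ _)
  have hcs : (1000 : ℝ) ∈ s := by simp [hs]
  have hTs : ∀ y ∈ T, y ∈ s := fun y hy => by simp [hs, hy]
  have hrange : ∀ y ∈ s, y = 0 ∨ (1 ≤ y ∧ y ≤ 4000 * (J : ℝ) ^ 2) := by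
    have hJ' : (1 : ℝ) ≤ J := by exact_mod_cast hJ
    intro y hy
    rw [hs, Finset.mem_insert, Finset.mem_insert, Finset.mem_insert] at hy
    rcases hy with rfl | rfl | rfl | hy
    · exact Or.inl rfl
    · exact Or.inr ⟨le_rfl, by nlinarith⟩
    · exact Or.inr ⟨by norm_num, by nlinarith⟩
    · refine Or.inr ⟨by linarith [T_ge y hy], ?_⟩
      obtain ⟨j, hj, rfl⟩ := Finset.mem_image.1 hy
      have h1 : (j : ℝ) ≤ J := by exact_mod_cast (Finset.mem_Icc.1 hj).2
      have h2 : (0 : ℝ) ≤ j := Nat.cast_nonneg j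
      simp only [hg]; nlinarith
  have hWc : |relNodalWeight s 1000| ≤ 2 / 999 := by
    rw [abs_relNodalWeight h0s hcs (by norm_num), e0, Finset.insert_comm, Finset.erase_insert (by
      rw [Finset.mem_insert, not_or]; exact ⟨by norm_num, c1⟩),
      Finset.prod_insert (nT _ (by norm_num)), hT, Finset.prod_image (fun _ _ _ _ h => g_inj h)]
    have hP : ∏ j ∈ Finset.Icc 1 J, |g j / (g j - 1000)|
        = (∏ j ∈ Finset.Icc 1 J, (1 - 1 / 4 * (1 / (j : ℝ) ^ 2)))⁻¹ := by
      rw [← Finset.prod_inv_distrib]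
      refine Finset.prod_congr rfl fun j hj => ?_
      have h1 := g_ge j hj
      have h2 : (0 : ℝ) < j := by exact_mod_cast (Finset.mem_Icc.1 hj).1
      rw [abs_of_nonneg (div_nonneg (by linarith) (by linarith))]
      have h3 : g j - 1000 ≠ 0 := by linarith
      have h4 : (1 - 1 / 4 * (1 / (j : ℝ) ^ 2)) = (g j - 1000) / g j := by
        simp only [hg]; field_simp; ring
      rw [h4, inv_div]
    have hL : (1 : ℝ) / 2 ≤ ∏ j ∈ Finset.Icc 1 J, (1 - 1 / 4 * (1 / (j : ℝ) ^ 2)) := by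
      refine le_trans ?_ (one_sub_sum_le_prod_one_sub _ _ (fun j _ => by positivity) ?_)
      · rw [← Finset.mul_sum]
        linarith [sum_inv_sq_le_two J]
      · intro j hj
        have h2 : (1 : ℝ) ≤ j := by exact_mod_cast (Finset.mem_Icc.1 hj).1
        have : 1 / (j : ℝ) ^ 2 ≤ 1 := by
          rw [div_le_one (by positivity)]; nlinarith
        linarith
    have hI := inv_anti₀ (by norm_num) hL
    rw [hP]
    have : |(1 : ℝ) / (1 - 1000)| = 1 / 999 := by
      rw [abs_of_neg] <;> norm_num
    rw [this]
    norm_num at hI ⊢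
    linarith
  -- The node `1` gives a factor at most `2 / g j`, the node `1000` at most `2000 / g j`, and the
  -- other grid nodes together at most `2`.
  have hWj : ∀ j ∈ Finset.Icc 1 J, |relNodalWeight s (g j)| ≤ 8000 / (g j) ^ 2 := by
    intro j hj
    have hgj := g_ge j hj
    have hgT : g j ∈ T := Finset.mem_image_of_mem _ hj
    have hj0 : (0 : ℝ) < j := by exact_mod_cast (Finset.mem_Icc.1 hj).1
    have e2 : (s.erase 0).erase (g j) = insert 1 (insert 1000 (((Finset.Icc 1 J).erase j).image g)) := by
      rw [e0, Finset.erase_insert_of_ne (by linarith), Finset.erase_insert_of_ne (by linarith), hT,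
        Finset.image_erase g_inj]
    have sub : ((Finset.Icc 1 J).erase j).image g ⊆ T :=
      Finset.image_subset_image (Finset.erase_subset _ _)
    rw [abs_relNodalWeight h0s (hTs _ hgT) (by linarith), e2, Finset.prod_insert
      (fun h => c2 (Finset.insert_subset_insert _ sub h)), Finset.prod_insert (fun h => c1 (sub h)),
      Finset.prod_image (fun _ _ _ _ h => g_inj h)]
    have hP : ∏ i ∈ (Finset.Icc 1 J).erase j, |g i / (g i - g j)| ≤ 2 := by
      refine le_trans (le_of_eq ?_)
        (prod_abs_sq_div_sub_sq_le (Finset.mem_Icc.1 hj).1 (Finset.mem_Icc.1 hj).2)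
      refine Finset.prod_congr rfl fun i hi => ?_
      simp only [hg]
      rw [← mul_sub, mul_div_mul_left _ _ (by norm_num)]
    have hP0 : 0 ≤ ∏ i ∈ (Finset.Icc 1 J).erase j, |g i / (g i - g j)| :=
      Finset.prod_nonneg fun _ _ => abs_nonneg _
    have a1 : |(1 : ℝ) / (1 - g j)| ≤ 2 / g j := by
      rw [abs_div, abs_one, abs_of_neg (by linarith), div_le_div_iff₀ (by linarith) (by linarith)]
      linarith
    have a2 : |(1000 : ℝ) / (1000 - g j)| ≤ 2000 / g j := by
      rw [abs_div, abs_of_neg (by linarith : 1000 - g j < 0), abs_of_pos (by norm_num),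
        div_le_div_iff₀ (by linarith) (by linarith)]
      linarith
    have hgp : 0 < g j := by linarith
    calc _ ≤ 2 / g j * (2000 / g j * 2) := by gcongr
      _ = _ := by field_simp; norm_num
  have hsumT : ∀ F : ℝ → ℝ, ∑ y ∈ T, F y = ∑ j ∈ Finset.Icc 1 J, F (g j) := fun F =>
    Finset.sum_image (fun _ _ _ _ h => g_inj h)
  have hWy : ∀ j ∈ Finset.Icc 1 J, |relNodalWeight s (g j)| * g j ≤ 2 * (1 / (j : ℝ) ^ 2) := by
    intro j hj
    have hgj := g_ge j hj
    have hj0 : (0 : ℝ) < j := by exact_mod_cast (Finset.mem_Icc.1 hj).1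
    calc _ ≤ 8000 / (g j) ^ 2 * g j := mul_le_mul_of_nonneg_right (hWj j hj) (by linarith)
      _ = _ := by simp only [hg]; field_simp; norm_num
  have hsum2 : ∑ y ∈ T, |relNodalWeight s y| * y ≤ 4 := by
    rw [hsumT]
    refine (Finset.sum_le_sum hWy).trans ?_
    rw [← Finset.mul_sum]; linarith [sum_inv_sq_le_two J]
  have hsum1 : ∑ y ∈ T, |relNodalWeight s y| ≤ 1 / 1000 := by
    have : ∑ y ∈ T, |relNodalWeight s y| * 4000 ≤ ∑ y ∈ T, |relNodalWeight s y| * y :=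
      Finset.sum_le_sum fun y hy => mul_le_mul_of_nonneg_left (T_ge y hy) (abs_nonneg _)
    rw [← Finset.sum_mul] at this
    linarith
  obtain ⟨P, Q, hP, hQ, hP1, hQ1, hm, hQ0, hη, hμ⟩ :=
    exists_laws_of_signed s (relNodalWeight s) (J + 1) h0s h1s
      (fun y hy => by rcases hrange y hy with h | h <;> linarith)
      (relNodalWeight_zero s) (by omega)
      (fun j hj => sum_relNodalWeight_mul_pow s j (by omega)) (η := 1 / 200) (μ := 7)
      (by rw [e1, Finset.sum_insert c1]; linarith) (by norm_num)
      (by rw [e1, Finset.sum_insert c1]; linarith)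
  exact ⟨s, P, Q, hrange, h0s, hP, hQ, hP1, hQ1, hm, hQ0, hη, hμ⟩

/-! ### Rejection sampling as a polynomial in the weights. -/

/-- Among `m` raw slots, slot `j` carries the symbol `idx j`, accepted with probability
`u (idx j) / l`. This polynomial in `u` is the expectation of `φ` at the first `q` accepted symbols
(and of `0` if fewer than `q` are accepted). -/
noncomputable def acceptPoly {N : ℕ} (l : ℝ) : (m q : ℕ) → ((Fin q → Fin N) → ℝ) →
    (Fin m → Fin N) → MvPolynomial (Fin N) ℝ
  | _, 0, φ, _ => MvPolynomial.C (φ Fin.elim0)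
  | 0, _ + 1, _, _ => 0
  | m + 1, q + 1, φ, idx =>
    MvPolynomial.C l⁻¹ * MvPolynomial.X (idx 0) *
        acceptPoly l m q (fun t => φ (Fin.cons (idx 0) t)) (Fin.tail idx) +
      (1 - MvPolynomial.C l⁻¹ * MvPolynomial.X (idx 0)) *
        acceptPoly l m (q + 1) φ (Fin.tail idx)

/-- The probability of at least `q` successes in `m` independent trials of success probability
`S`. -/
noncomputable def acceptProb (S : ℝ) : ℕ → ℕ → ℝ
  | _, 0 => 1
  | 0, _ + 1 => 0
  | m + 1, q + 1 => S * acceptProb S m q + (1 - S) * acceptProb S m (q + 1)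

lemma acceptProb_mem {S : ℝ} (h0 : 0 ≤ S) (h1 : S ≤ 1) (m q : ℕ) :
    0 ≤ acceptProb S m q ∧ acceptProb S m q ≤ 1 := by
  induction m generalizing q with
  | zero => cases q <;> simp [acceptProb]
  | succ m ih =>
    cases q with
    | zero => simp [acceptProb]
    | succ q =>
      obtain ⟨a0, a1⟩ := ih q
      obtain ⟨b0, b1⟩ := ih (q + 1)
      simp only [acceptProb]
      constructor
      · have : 0 ≤ 1 - S := by linarith
        positivity
      · nlinarith

/-- This is Chernoff's bound with base `1 / 2`: the expectation of `2 ^ (-successes)` is `(1 - S /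
2) ^ m`. -/
lemma one_sub_acceptProb_le {S : ℝ} (h0 : 0 ≤ S) (h1 : S ≤ 1) (m q : ℕ) :
    1 - acceptProb S m q ≤ 2 ^ q * (1 - S / 2) ^ m := by
  have hb : 0 ≤ 1 - S / 2 := by linarith
  induction m generalizing q with
  | zero =>
    cases q with
    | zero => simp [acceptProb]
    | succ q =>
      simp only [acceptProb, pow_zero, mul_one, sub_zero]
      exact one_le_pow₀ (by norm_num)
  | succ m ih =>
    cases q with
    | zero => simp only [acceptProb, sub_self]; positivity
    | succ q =>
      have a := mul_le_mul_of_nonneg_left (ih q) h0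
      have b := mul_le_mul_of_nonneg_left (ih (q + 1)) (by linarith : 0 ≤ 1 - S)
      simp only [acceptProb]
      calc _ = S * (1 - acceptProb S m q) + (1 - S) * (1 - acceptProb S m (q + 1)) := by ring
        _ ≤ S * (2 ^ q * (1 - S / 2) ^ m) + (1 - S) * (2 ^ (q + 1) * (1 - S / 2) ^ m) :=
          add_le_add a b
        _ = _ := by ring

lemma le_acceptProb {S : ℝ} (h0 : 0 ≤ S) (h1 : S ≤ 1) (m q : ℕ) :
    1 - 2 ^ q * Real.exp (-(m * S / 2)) ≤ acceptProb S m q := by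
  have h := one_sub_acceptProb_le h0 h1 m q
  have h2 : (1 - S / 2) ^ m ≤ Real.exp (-(m * S / 2)) := by
    have : 1 - S / 2 ≤ Real.exp (-(S / 2)) := by
      have := Real.add_one_le_exp (-(S / 2)); linarith
    calc (1 - S / 2) ^ m ≤ Real.exp (-(S / 2)) ^ m := pow_le_pow_left₀ (by linarith) this m
      _ = _ := by rw [← Real.exp_nat_mul]; congr 1; ring
  have h3 := mul_le_mul_of_nonneg_left h2 (by positivity : (0 : ℝ) ≤ 2 ^ q)
  linarith

section Accept

variable {N : ℕ} {l : ℝ}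

/-- Each slot multiplies by a factor that is affine in the variable of its own symbol and free of
all others. -/
lemma degreeOf_acceptPoly_le (m q : ℕ) (φ : (Fin q → Fin N) → ℝ) (idx : Fin m → Fin N)
    (v : Fin N) :
    (acceptPoly l m q φ idx).degreeOf v ≤ (Finset.univ.filter fun j => idx j = v).card := by
  induction m generalizing q with
  | zero => cases q <;> simp [acceptPoly, MvPolynomial.degreeOf_C]
  | succ m ih =>
    cases q with
    | zero => simp [acceptPoly, MvPolynomial.degreeOf_C]
    | succ q =>
      have hX : (MvPolynomial.C l⁻¹ * MvPolynomial.X (idx 0) : MvPolynomial (Fin N) ℝ).degreeOf v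
          ≤ if idx 0 = v then 1 else 0 := by
        refine (MvPolynomial.degreeOf_mul_le _ _ _).trans ?_
        rw [MvPolynomial.degreeOf_C, MvPolynomial.degreeOf_X, zero_add]
        simp only [eq_comm, le_refl]
      have hX' : (1 - MvPolynomial.C l⁻¹ * MvPolynomial.X (idx 0) :
          MvPolynomial (Fin N) ℝ).degreeOf v ≤ if idx 0 = v then 1 else 0 := by
        refine (MvPolynomial.degreeOf_sub_le _ _ _).trans (max_le ?_ hX)
        simp
      rw [Fin.card_filter_univ_succ]
      have hs : (if idx 0 = v then
            (Finset.univ.filter ((fun j => idx j = v) ∘ Fin.succ)).card + 1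
          else (Finset.univ.filter ((fun j => idx j = v) ∘ Fin.succ)).card)
          = (if idx 0 = v then 1 else 0) +
            (Finset.univ.filter fun j => Fin.tail idx j = v).card := by
        have : (Finset.univ.filter ((fun j => idx j = v) ∘ Fin.succ)).card
          = (Finset.univ.filter fun j => Fin.tail idx j = v).card := rfl
        split_ifs <;> omega
      refine le_trans ?_ (le_of_eq hs.symm)
      rw [acceptPoly]
      refine (MvPolynomial.degreeOf_add_le _ _ _).trans (max_le ?_ ?_)
      · exact (MvPolynomial.degreeOf_mul_le _ _ _).trans (add_le_add hX (ih _ _ _))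
      · exact (MvPolynomial.degreeOf_mul_le _ _ _).trans (add_le_add hX' (ih _ _ _))

lemma eval_acceptPoly_mem (hl : 0 < l) {u : Fin N → ℝ} (hu : ∀ i, 0 ≤ u i ∧ u i ≤ l) (m q : ℕ)
    (φ : (Fin q → Fin N) → ℝ) (hφ : ∀ t, 0 ≤ φ t ∧ φ t ≤ 1) (idx : Fin m → Fin N) :
    0 ≤ MvPolynomial.eval u (acceptPoly l m q φ idx) ∧
      MvPolynomial.eval u (acceptPoly l m q φ idx) ≤ 1 := by
  induction m generalizing q with
  | zero =>
    cases q
    · simpa [acceptPoly] using hφ _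
    · simp [acceptPoly]
  | succ m ih =>
    cases q with
    | zero => simpa [acceptPoly] using hφ _
    | succ q =>
      obtain ⟨a0, a1⟩ := ih q (fun t => φ (Fin.cons (idx 0) t)) (fun t => hφ _) (Fin.tail idx)
      obtain ⟨b0, b1⟩ := ih (q + 1) φ hφ (Fin.tail idx)
      have hp0 : 0 ≤ l⁻¹ * u (idx 0) := mul_nonneg (by positivity) (hu _).1
      have hp1 : l⁻¹ * u (idx 0) ≤ 1 := by
        rw [inv_mul_le_iff₀ hl, mul_one]; exact (hu _).2
      simp only [acceptPoly, map_add, map_mul, map_sub, map_one, MvPolynomial.eval_C,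
        MvPolynomial.eval_X]
      generalize l⁻¹ * u (idx 0) = r at *
      have : 0 ≤ 1 - r := by linarith
      constructor
      · positivity
      · nlinarith

lemma sum_fin_succ_fun {M : Type*} [AddCommMonoid M] (m : ℕ) (F : (Fin (m + 1) → Fin N) → M) :
    ∑ t, F t = ∑ i : Fin N, ∑ t : Fin m → Fin N, F (Fin.cons i t) := by
  rw [← (Fin.consEquiv fun _ : Fin (m + 1) => Fin N).sum_comp, Fintype.sum_prod_type]
  rfl

/-- The raw sampling process produces `q` accepted symbols that are independent samples from the
distribution proportional to `u`. -/
lemma sum_eval_acceptPoly {u p : Fin N → ℝ} {S : ℝ} (hp : ∑ i, p i = 1)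
    (hpS : ∀ i, u i = l * N * S * p i) (hl : l ≠ 0) (hN : N ≠ 0) (m q : ℕ)
    (φ : (Fin q → Fin N) → ℝ) :
    ∑ idx, MvPolynomial.eval u (acceptPoly l m q φ idx) =
      (N : ℝ) ^ m * (acceptProb S m q * ∑ t, (∏ j, p (t j)) * φ t) := by
  have hN' : (N : ℝ) ≠ 0 := by exact_mod_cast hN
  induction m generalizing q with
  | zero =>
    cases q with
    | zero => simpa [acceptPoly, acceptProb] using congrArg φ (Subsingleton.elim _ _)
    | succ q => simp [acceptPoly, acceptProb]
  | succ m ih =>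
    cases q with
    | zero => simpa [acceptPoly, acceptProb] using Or.inl (congrArg φ (Subsingleton.elim _ _))
    | succ q =>
      rw [sum_fin_succ_fun, sum_fin_succ_fun]
      simp only [acceptPoly, map_add, map_mul, map_sub, map_one, MvPolynomial.eval_C,
        MvPolynomial.eval_X, Fin.cons_zero, Fin.tail_cons, Finset.sum_add_distrib,
        ← Finset.mul_sum, ih, Fin.prod_univ_succ, Fin.cons_succ, acceptProb, mul_assoc]
      rw [sum_fin_succ_fun]
      simp only [Fin.cons_zero, Fin.cons_succ, ← Finset.mul_sum]
      have e1 : ∀ i, l⁻¹ * u i = N * S * p i := by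
        intro i; rw [hpS]; field_simp
      set E := ∑ i, p i * ∑ t : Fin q → Fin N, (∏ j, p (t j)) * φ (Fin.cons i t) with hE
      have h1 : l⁻¹ * ∑ i, (u i * ((N : ℝ) ^ m * (acceptProb S m q *
          ∑ t : Fin q → Fin N, (∏ j, p (t j)) * φ (Fin.cons i t)))) =
          (N : ℝ) ^ (m + 1) * (S * (acceptProb S m q * E)) := by
        rw [hE, Finset.mul_sum, Finset.mul_sum, Finset.mul_sum, Finset.mul_sum]
        refine Finset.sum_congr rfl fun i _ => ?_
        rw [← mul_assoc, e1]; ring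
      have h2 : ∑ i, (1 - l⁻¹ * u i) = N * (1 - S) := by
        simp only [e1, Finset.sum_sub_distrib, ← Finset.mul_sum, hp]
        simp; ring
      rw [h1, ← Finset.sum_mul, h2]
      ring

end Accept

/-! ### Expectations under product laws. -/

/-- The expectation of `g u`, where the coordinates of `u` are independent with law `P` on `s`. -/
noncomputable def prodExp (s : Finset ℝ) (P : ℝ → ℝ) (N : ℕ) (g : (Fin N → ℝ) → ℝ) : ℝ :=
  ∑ u ∈ Fintype.piFinset fun _ : Fin N => s, (∏ i, P (u i)) * g u

section ProdExp

variable {s : Finset ℝ} {P Q : ℝ → ℝ} {N : ℕ}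

lemma prodExp_prod (g : Fin N → ℝ → ℝ) :
    prodExp s P N (fun u => ∏ i, g i (u i)) = ∏ i, ∑ y ∈ s, P y * g i y := by
  rw [prodExp, Finset.prod_univ_sum]
  exact Finset.sum_congr rfl fun u _ => Finset.prod_mul_distrib.symm

lemma prodExp_const (hP : ∑ y ∈ s, P y = 1) (c : ℝ) : prodExp s P N (fun _ => c) = c := by
  have h := prodExp_prod (s := s) (P := P) (N := N) (fun _ _ => 1)
  simp only [mul_one, hP, Finset.prod_const_one] at h
  simp only [prodExp, mul_one, ← Finset.sum_mul] at h ⊢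
  rw [h, one_mul]

/-- Comparing only where `P (u i) ≠ 0` matters for the law with `Q 0 = 0`: all its weights may be
taken at least `1` although `0 ∈ s`. -/
lemma prodExp_mono (hP : ∀ y, 0 ≤ P y) {g h : (Fin N → ℝ) → ℝ}
    (hgh : ∀ u, (∀ i, u i ∈ s) → (∀ i, P (u i) ≠ 0) → g u ≤ h u) :
    prodExp s P N g ≤ prodExp s P N h := by
  refine Finset.sum_le_sum fun u hu => ?_
  by_cases h0 : ∀ i, P (u i) ≠ 0
  · exact mul_le_mul_of_nonneg_left (hgh u (Fintype.mem_piFinset.1 hu) h0)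
      (Finset.prod_nonneg fun i _ => hP _)
  · push Not at h0
    obtain ⟨i, hi⟩ := h0
    rw [Finset.prod_eq_zero (Finset.mem_univ i) hi, zero_mul, zero_mul]

lemma prodExp_add (g h : (Fin N → ℝ) → ℝ) :
    prodExp s P N (fun u => g u + h u) = prodExp s P N g + prodExp s P N h := by
  simp only [prodExp, mul_add, Finset.sum_add_distrib]

lemma prodExp_const_mul (c : ℝ) (g : (Fin N → ℝ) → ℝ) :
    prodExp s P N (fun u => c * g u) = c * prodExp s P N g := by
  simp only [prodExp, Finset.mul_sum]
  exact Finset.sum_congr rfl fun u _ => by ring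

lemma prodExp_sum {κ : Type*} (A : Finset κ) (g : κ → (Fin N → ℝ) → ℝ) :
    prodExp s P N (fun u => ∑ a ∈ A, g a u) = ∑ a ∈ A, prodExp s P N (g a) := by
  simp only [prodExp, Finset.mul_sum]
  exact Finset.sum_comm

lemma prodExp_coord (hP : ∑ y ∈ s, P y = 1) (g : ℝ → ℝ) (i : Fin N) :
    prodExp s P N (fun u => g (u i)) = ∑ y ∈ s, P y * g y := by
  have h := prodExp_prod (s := s) (P := P) (N := N) (fun k y => if k = i then g y else 1)
  simp only [Finset.prod_ite_eq', Finset.mem_univ, if_true] at h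
  rw [h, Finset.prod_eq_single i]
  · simp
  · intro b _ hb; simp [hb, hP]
  · simp

lemma prodExp_sum_coord (hP : ∑ y ∈ s, P y = 1) (g : ℝ → ℝ) :
    prodExp s P N (fun u => ∑ i, g (u i)) = N * ∑ y ∈ s, P y * g y := by
  rw [prodExp_sum Finset.univ (fun i u => g (u i))]
  simp [prodExp_coord hP]

/-- By independence the expectation of a monomial is a product of moments, each of order at most
`L`; the total degree is irrelevant. -/
lemma prodExp_eval_eq {L : ℕ} (hm : ∀ j ≤ L, ∑ y ∈ s, P y * y ^ j = ∑ y ∈ s, Q y * y ^ j)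
    (F : MvPolynomial (Fin N) ℝ) (hF : ∀ v, F.degreeOf v ≤ L) :
    prodExp s P N (fun u => MvPolynomial.eval u F) =
      prodExp s Q N (fun u => MvPolynomial.eval u F) := by
  simp only [MvPolynomial.eval_eq']
  rw [prodExp_sum F.support (fun d u => F.coeff d * ∏ i, u i ^ d i),
    prodExp_sum F.support (fun d u => F.coeff d * ∏ i, u i ^ d i)]
  refine Finset.sum_congr rfl fun d hd => ?_
  rw [prodExp_const_mul, prodExp_const_mul, prodExp_prod (fun i y => y ^ d i),
    prodExp_prod (fun i y => y ^ d i)]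
  congr 1
  exact Finset.prod_congr rfl fun i _ => hm _ ((MvPolynomial.monomial_le_degreeOf i hd).trans (hF i))

end ProdExp

/-! ### The lower bound for testing support size. -/

section Core

variable {s : Finset ℝ} {P Q : ℝ → ℝ} {N : ℕ} {l : ℝ}

/-- The normalised sum over all symbol sequences of `acceptPoly`. -/
noncomputable def acceptMean (l : ℝ) {N : ℕ} (m q : ℕ) (φ : (Fin q → Fin N) → ℝ)
    (u : Fin N → ℝ) : ℝ :=
  ((N : ℝ) ^ m)⁻¹ * ∑ idx, MvPolynomial.eval u (acceptPoly l m q φ idx)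

/-- A union bound over symbols and Markov's inequality for `8 ^ count`, whose mean is `(1 + 7 / N) ^
m`, bound the chance that some symbol is proposed more than `L` times. -/
lemma sum_exists_count_le (m L : ℕ) (hN : N ≠ 0) :
    ((N : ℝ) ^ m)⁻¹ * ∑ idx : Fin m → Fin N,
      (if ∀ v, (Finset.univ.filter fun j => idx j = v).card ≤ L then (0 : ℝ) else 1) ≤
      N * ((8 : ℝ)⁻¹ ^ (L + 1) * Real.exp (7 * m / N)) := by
  have hN' : (0 : ℝ) < N := by exact_mod_cast Nat.pos_of_ne_zero hN
  have h1 : ∀ idx : Fin m → Fin N,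
      (if ∀ v, (Finset.univ.filter fun j => idx j = v).card ≤ L then (0 : ℝ) else 1) ≤
        ∑ v, (8 : ℝ)⁻¹ ^ (L + 1) * ∏ j, (if idx j = v then 8 else 1) := by
    intro idx
    have hnn : ∀ v ∈ Finset.univ, 0 ≤ (8 : ℝ)⁻¹ ^ (L + 1) *
        ∏ j, (if idx j = v then (8 : ℝ) else 1) := fun v _ =>
      mul_nonneg (by positivity) (Finset.prod_nonneg fun j _ => by split_ifs <;> norm_num)
    split_ifs with h
    · exact Finset.sum_nonneg hnn
    · push Not at h
      obtain ⟨v, hv⟩ := h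
      refine le_trans ?_ (Finset.single_le_sum hnn (Finset.mem_univ v))
      rw [Finset.prod_ite, Finset.prod_const, Finset.prod_const_one, mul_one, inv_pow,
        inv_mul_eq_div, le_div_iff₀ (by positivity), one_mul]
      exact pow_le_pow_right₀ (by norm_num) hv
  have h2 : ∀ v : Fin N, ∑ idx : Fin m → Fin N, ∏ j, (if idx j = v then (8 : ℝ) else 1)
      = (N + 7) ^ m := by
    intro v
    rw [← Fintype.sum_pow (fun i : Fin N => if i = v then (8 : ℝ) else 1)]
    congr 1
    have : ∀ i : Fin N, (if i = v then (8 : ℝ) else 1) = 1 + if i = v then 7 else 0 := by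
      intro i; split_ifs <;> norm_num
    simp [this, Finset.sum_add_distrib]
  have h3 : ((N : ℝ) ^ m)⁻¹ * (N + 7) ^ m ≤ Real.exp (7 * m / N) := by
    rw [inv_mul_eq_div, ← div_pow]
    have : ((N : ℝ) + 7) / N ≤ Real.exp (7 / N) := by
      have := Real.add_one_le_exp (7 / (N : ℝ))
      rw [add_div, div_self hN'.ne']; linarith
    calc _ ≤ Real.exp (7 / N) ^ m := pow_le_pow_left₀ (by positivity) this m
      _ = _ := by rw [← Real.exp_nat_mul]; congr 1; ring
  calc _ ≤ ((N : ℝ) ^ m)⁻¹ * ∑ idx : Fin m → Fin N,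
        ∑ v, (8 : ℝ)⁻¹ ^ (L + 1) * ∏ j, (if idx j = v then 8 else 1) :=
      mul_le_mul_of_nonneg_left (Finset.sum_le_sum fun idx _ => h1 idx) (by positivity)
    _ = N * ((8 : ℝ)⁻¹ ^ (L + 1) * (((N : ℝ) ^ m)⁻¹ * (N + 7) ^ m)) := by
      rw [Finset.sum_comm]
      simp only [← Finset.mul_sum, h2]
      simp; ring
    _ ≤ _ := by gcongr

/-- Proposal sequences without a symbol of multiplicity above `L` contribute equally to both sides;
every other one costs at most `1`. -/
lemma prodExp_acceptMean_le {L : ℕ} (hP : ∀ y, 0 ≤ P y) (hQ : ∀ y, 0 ≤ Q y)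
    (hP1 : ∑ y ∈ s, P y = 1)
    (hm : ∀ j ≤ L, ∑ y ∈ s, P y * y ^ j = ∑ y ∈ s, Q y * y ^ j)
    (hl : 0 < l) (hs : ∀ y ∈ s, 0 ≤ y ∧ y ≤ l) (hN : N ≠ 0) (m q : ℕ)
    (φ : (Fin q → Fin N) → ℝ) (hφ : ∀ t, 0 ≤ φ t ∧ φ t ≤ 1) :
    prodExp s P N (acceptMean l m q φ) ≤ prodExp s Q N (acceptMean l m q φ) +
      N * ((8 : ℝ)⁻¹ ^ (L + 1) * Real.exp (7 * m / N)) := by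
  have hE : ∀ R : ℝ → ℝ, prodExp s R N (acceptMean l m q φ) = ((N : ℝ) ^ m)⁻¹ *
      ∑ idx, prodExp s R N (fun u => MvPolynomial.eval u (acceptPoly l m q φ idx)) := by
    intro R
    rw [← prodExp_sum, ← prodExp_const_mul]
    rfl
  rw [hE, hE]
  refine le_trans ?_ (add_le_add_right (sum_exists_count_le m L hN) _)
  rw [← mul_add, ← Finset.sum_add_distrib]
  refine mul_le_mul_of_nonneg_left (Finset.sum_le_sum fun idx _ => ?_) (by positivity)
  split_ifs with h
  · rw [add_zero]
    exact (prodExp_eval_eq hm _ fun v => (degreeOf_acceptPoly_le m q φ idx v).trans (h v)).le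
  · have h1 : prodExp s P N (fun u => MvPolynomial.eval u (acceptPoly l m q φ idx)) ≤ 1 := by
      rw [← prodExp_const (N := N) hP1 1]
      exact prodExp_mono hP fun u hu _ =>
        (eval_acceptPoly_mem hl (fun i => hs _ (hu i)) m q φ hφ idx).2
    have h2 : 0 ≤ prodExp s Q N (fun u => MvPolynomial.eval u (acceptPoly l m q φ idx)) := by
      have : prodExp s Q N (fun _ => 0) = 0 := by simp [prodExp]
      rw [← this]
      exact prodExp_mono hQ fun u hu _ =>
        (eval_acceptPoly_mem hl (fun i => hs _ (hu i)) m q φ hφ idx).1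
    linarith

/-- The probability distribution proportional to `u` (a point mass if `u = 0`). -/
noncomputable def normalizeDist [NeZero N] (u : Fin N → ℝ) (i : Fin N) : ℝ :=
  if ∑ j, u j = 0 then (if i = 0 then 1 else 0) else u i / ∑ j, u j

lemma sum_normalizeDist [NeZero N] (u : Fin N → ℝ) : ∑ i, normalizeDist u i = 1 := by
  unfold normalizeDist
  split_ifs with h
  · simp
  · rw [← Finset.sum_div, div_self h]

lemma normalizeDist_nonneg [NeZero N] {u : Fin N → ℝ} (hu : ∀ i, 0 ≤ u i) (i : Fin N) :
    0 ≤ normalizeDist u i := by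
  unfold normalizeDist
  split_ifs
  · norm_num
  · norm_num
  · exact div_nonneg (hu i) (Finset.sum_nonneg fun j _ => hu j)

/-- A proposal is accepted with probability `(∑ j, u j) / (l * N)`, and an accepted symbol has law
`normalizeDist u`, so acceptance and verdict factor. -/
lemma acceptMean_eq [NeZero N] {u : Fin N → ℝ} (hu : ∀ i, 0 ≤ u i) (hl : 0 < l) (m q : ℕ)
    (φ : (Fin q → Fin N) → ℝ) :
    acceptMean l m q φ u = acceptProb ((∑ j, u j) / (l * N)) m q *
      ∑ t, (∏ j, normalizeDist u (t j)) * φ t := by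
  have hN' : (N : ℝ) ≠ 0 := by exact_mod_cast NeZero.ne N
  rw [acceptMean, sum_eval_acceptPoly (S := (∑ j, u j) / (l * N)) (sum_normalizeDist u) _ hl.ne'
    (NeZero.ne N), inv_mul_cancel_left₀ (pow_ne_zero _ hN')]
  intro i
  unfold normalizeDist
  have hl' := hl.ne'
  by_cases h : ∑ j, u j = 0
  · rw [h, zero_div, mul_zero, zero_mul]
    exact (Finset.sum_eq_zero_iff_of_nonneg fun j _ => hu j).1 h i (Finset.mem_univ _)
  · rw [if_neg h]; field_simp

lemma card_normalizeDist_le [NeZero N] (u : Fin N → ℝ) {a : ℕ} (ha : 1 ≤ a)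
    (h : (Finset.univ.filter fun i => u i ≠ 0).card ≤ a) :
    (Finset.univ.filter fun i => normalizeDist u i ≠ 0).card ≤ a := by
  unfold normalizeDist
  by_cases h0 : ∑ j, u j = 0
  · refine le_trans ?_ ha
    simp [h0, Finset.filter_eq']
  · refine le_trans (Finset.card_le_card fun i => ?_) h
    simp only [Finset.mem_filter, Finset.mem_univ, true_and, if_neg h0]
    intro hi h'
    exact hi (by rw [h', zero_div])

lemma sum_prod_mul_le_one {p : Fin N → ℝ} (hp0 : ∀ i, 0 ≤ p i) (hp1 : ∑ i, p i = 1) {q : ℕ}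
    {φ : (Fin q → Fin N) → ℝ} (hφ : ∀ t, 0 ≤ φ t ∧ φ t ≤ 1) :
    0 ≤ ∑ t, (∏ j, p (t j)) * φ t ∧ ∑ t, (∏ j, p (t j)) * φ t ≤ 1 := by
  have h := Fintype.sum_pow p q
  rw [hp1, one_pow] at h
  constructor
  · exact Finset.sum_nonneg fun t _ => mul_nonneg (Finset.prod_nonneg fun j _ => hp0 _) (hφ t).1
  · rw [h]
    exact Finset.sum_le_sum fun t _ =>
      mul_le_of_le_one_right (Finset.prod_nonneg fun j _ => hp0 _) (hφ t).2

/-- No function of `q` samples separates the distributions on `N` symbols with support at most `a`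
from those with all probabilities at least `1 / (140 N)`. -/
theorem no_support_size_test_aux {J m q a : ℕ} (hN : N ≠ 0) (hJ : 1 ≤ J) (hNa : N ≤ 6 * a)
    (hδ : N * ((8 : ℝ)⁻¹ ^ (J + 2) * Real.exp (7 * m / N)) ≤ 1 / 40)
    (hacc : 2 ^ q * Real.exp (-(m * (1 / (4000 * (J : ℝ) ^ 2)) / 2)) ≤ 1 / 10)
    (φ : (Fin q → Fin N) → ℝ) (hφ : ∀ t, 0 ≤ φ t ∧ φ t ≤ 1)
    (hnear : ∀ p : Fin N → ℝ, (∀ i, 0 ≤ p i) → ∑ i, p i = 1 →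
      (Finset.univ.filter fun i => p i ≠ 0).card ≤ a → 2 / 3 ≤ ∑ t, (∏ j, p (t j)) * φ t)
    (hfar : ∀ p : Fin N → ℝ, ∑ i, p i = 1 → (∀ i, 1 / (140 * N) ≤ p i) →
      ∑ t, (∏ j, p (t j)) * φ t ≤ 1 / 3) : False := by
  have : NeZero N := ⟨hN⟩
  have hNp : (0 : ℝ) < N := by exact_mod_cast Nat.pos_of_ne_zero hN
  have ha : 1 ≤ a := by omega
  have hap : (0 : ℝ) < a := by exact_mod_cast ha
  have hNa' : (N : ℝ) ≤ 6 * a := by exact_mod_cast hNa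
  obtain ⟨s, P, Q, hrange, h0s, hP, hQ, hP1, hQ1, hm, hQ0, hPη, hQμ⟩ := exists_moment_matching J hJ
  have hJ' : (1 : ℝ) ≤ J := by exact_mod_cast hJ
  set l : ℝ := 4000 * (J : ℝ) ^ 2 with hl_def
  have hl : 0 < l := by positivity
  have hs : ∀ y ∈ s, 0 ≤ y ∧ y ≤ l := by
    intro y hy
    rcases hrange y hy with rfl | h
    · exact ⟨le_rfl, hl.le⟩
    · exact ⟨by linarith [h.1], h.2⟩
  have hS : ∀ u : Fin N → ℝ, (∀ i, u i ∈ s) →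
      0 ≤ (∑ j, u j) / (l * N) ∧ (∑ j, u j) / (l * N) ≤ 1 := by
    intro u hu
    refine ⟨div_nonneg (Finset.sum_nonneg fun i _ => (hs _ (hu i)).1) (by positivity), ?_⟩
    rw [div_le_one (by positivity)]
    calc ∑ j, u j ≤ ∑ _j : Fin N, l := Finset.sum_le_sum fun i _ => (hs _ (hu i)).2
      _ = l * N := by simp; ring
  -- the expected value under the law with large support
  have hfar' : prodExp s Q N (acceptMean l m q φ) ≤ 1 / 3 + 1 / 20 := by
    have hQE : prodExp s Q N (fun u => ∑ i, u i) ≤ N * 7 := by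
      rw [prodExp_sum_coord hQ1 (fun y => y)]
      exact mul_le_mul_of_nonneg_left hQμ hNp.le
    have : prodExp s Q N (acceptMean l m q φ) ≤
        prodExp s Q N (fun u => 1 / 3 + (140 * N : ℝ)⁻¹ * ∑ i, u i) := by
      refine prodExp_mono hQ fun u hu hu0 => ?_
      have hu1 : ∀ i, 1 ≤ u i := by
        intro i
        rcases hrange _ (hu i) with h | h
        · exact absurd (by rw [h]; exact hQ0) (hu0 i)
        · exact h.1
      have hupos : ∀ i, 0 ≤ u i := fun i => by linarith [hu1 i]
      have hsum : (N : ℝ) ≤ ∑ i, u i := by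
        calc (N : ℝ) = ∑ _i : Fin N, (1 : ℝ) := by simp
          _ ≤ _ := Finset.sum_le_sum fun i _ => hu1 i
      have hsum0 : 0 < ∑ i, u i := by linarith
      rw [acceptMean_eq hupos hl]
      obtain ⟨B0, B1⟩ := acceptProb_mem (hS u hu).1 (hS u hu).2 m q
      obtain ⟨E0, E1⟩ := sum_prod_mul_le_one (normalizeDist_nonneg hupos) (sum_normalizeDist u) hφ
      -- Markov's inequality: the mean of the sum is at most `7 N`, so the threshold `140 N` is
      -- exceeded with probability at most `1 / 20`.
      by_cases hbig : ∑ i, u i ≤ 140 * N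
      · have hE := hfar (normalizeDist u) (sum_normalizeDist u) (by
          intro i
          rw [normalizeDist, if_neg hsum0.ne']
          exact div_le_div₀ (by linarith [hu1 i]) (hu1 i) hsum0 hbig)
        have : 0 ≤ (140 * N : ℝ)⁻¹ * ∑ i, u i := by positivity
        exact (mul_le_of_le_one_left E0 B1).trans (by linarith)
      · push Not at hbig
        have : 1 ≤ (140 * N : ℝ)⁻¹ * ∑ i, u i := by
          rw [inv_mul_eq_div, one_le_div (by positivity)]; exact hbig.le
        exact (mul_le_one₀ B1 E0 E1).trans (by linarith)
    refine this.trans ?_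
    rw [prodExp_add, prodExp_const hQ1, prodExp_const_mul]
    have h2 : (140 * N : ℝ)⁻¹ * prodExp s Q N (fun u => ∑ i, u i) ≤ (140 * N : ℝ)⁻¹ * (N * 7) :=
      mul_le_mul_of_nonneg_left hQE (by positivity)
    have h3 : (140 * N : ℝ)⁻¹ * (N * 7) = 1 / 20 := by field_simp; norm_num
    linarith
  -- the acceptance probability
  have hone : ∀ t : Fin q → Fin N, (0 : ℝ) ≤ (fun _ => 1 : (Fin q → Fin N) → ℝ) t ∧
      (fun _ => 1 : (Fin q → Fin N) → ℝ) t ≤ 1 := fun t => ⟨by norm_num, le_rfl⟩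
  have hmean1 : ∀ u : Fin N → ℝ, (∀ i, u i ∈ s) → acceptMean l m q (fun _ => 1) u =
      acceptProb ((∑ j, u j) / (l * N)) m q := by
    intro u hu
    have h := Fintype.sum_pow (normalizeDist u) q
    rw [sum_normalizeDist, one_pow] at h
    rw [acceptMean_eq (fun i => (hs _ (hu i)).1) hl]
    simp only [mul_one]
    rw [← h, mul_one]
  have hB : 9 / 10 ≤ prodExp s Q N (acceptMean l m q fun _ => 1) := by
    rw [← prodExp_const (N := N) hQ1 (9 / 10)]
    refine prodExp_mono hQ fun u hu hu0 => ?_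
    rw [hmean1 u hu]
    have hsum : (N : ℝ) ≤ ∑ i, u i := by
      calc (N : ℝ) = ∑ _i : Fin N, (1 : ℝ) := by simp
        _ ≤ _ := Finset.sum_le_sum fun i _ => by
          rcases hrange _ (hu i) with h | h
          · exact absurd (by rw [h]; exact hQ0) (hu0 i)
          · exact h.1
    have hSl : 1 / l ≤ (∑ i, u i) / (l * N) := by
      rw [div_le_div_iff₀ hl (by positivity)]
      nlinarith
    refine le_trans ?_ (le_acceptProb (hS u hu).1 (hS u hu).2 m q)
    have hexp : Real.exp (-(m * ((∑ i, u i) / (l * N)) / 2)) ≤ Real.exp (-(m * (1 / l) / 2)) := by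
      gcongr
    have := mul_le_mul_of_nonneg_left hexp (by positivity : (0 : ℝ) ≤ 2 ^ q)
    linarith
  -- Under `P` the total weight has no pointwise lower bound. The acceptance probability is
  -- transferred from `Q` by comparing the laws on the constant test `1`.
  have hBP : 9 / 10 - 1 / 40 ≤ prodExp s P N (acceptMean l m q fun _ => 1) := by
    have := prodExp_acceptMean_le hQ hP hQ1 (fun j hj => (hm j hj).symm) hl hs hN m q _ hone
    linarith
  -- the expected value under the law with small support
  have hnear' : 2 / 3 * (prodExp s P N (acceptMean l m q fun _ => 1) - 3 / 100) ≤
      prodExp s P N (acceptMean l m q φ) := by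
    have hPE : prodExp s P N (fun u => ∑ i, if u i = 0 then (0 : ℝ) else 1) ≤ N * (1 / 200) := by
      rw [prodExp_sum_coord hP1 (fun y => if y = 0 then (0 : ℝ) else 1)]
      refine mul_le_mul_of_nonneg_left (le_trans (le_of_eq ?_) hPη) hNp.le
      rw [← Finset.add_sum_erase _ _ h0s, if_pos rfl, mul_zero, zero_add]
      exact Finset.sum_congr rfl fun y hy => by rw [if_neg (Finset.ne_of_mem_erase hy), mul_one]
    have : prodExp s P N (fun u => 2 / 3 * acceptMean l m q (fun _ => 1) u) ≤
        prodExp s P N (fun u => acceptMean l m q φ u +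
          2 / 3 * (a : ℝ)⁻¹ * ∑ i, if u i = 0 then (0 : ℝ) else 1) := by
      refine prodExp_mono hP fun u hu _ => ?_
      have hupos : ∀ i, 0 ≤ u i := fun i => (hs _ (hu i)).1
      rw [hmean1 u hu, acceptMean_eq hupos hl]
      obtain ⟨B0, B1⟩ := acceptProb_mem (hS u hu).1 (hS u hu).2 m q
      obtain ⟨E0, E1⟩ := sum_prod_mul_le_one (normalizeDist_nonneg hupos) (sum_normalizeDist u) hφ
      have hcount : ∑ i, (if u i = 0 then (0 : ℝ) else 1)
          = ((Finset.univ.filter fun i => u i ≠ 0).card : ℝ) := by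
        rw [Finset.card_filter]; push_cast
        exact Finset.sum_congr rfl fun i _ => by by_cases h : u i = 0 <;> simp [h]
      rw [hcount]
      -- Markov's inequality again: the mean support size is at most `N / 200 ≤ 3 a / 100`.
      by_cases hc : (Finset.univ.filter fun i => u i ≠ 0).card ≤ a
      · have hE := hnear (normalizeDist u) (normalizeDist_nonneg hupos) (sum_normalizeDist u)
          (card_normalizeDist_le u ha hc)
        have : 0 ≤ 2 / 3 * (a : ℝ)⁻¹ * ((Finset.univ.filter fun i => u i ≠ 0).card : ℝ) := by
          positivity
        nlinarith
      · push Not at hc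
        have hc' : (a : ℝ) ≤ (Finset.univ.filter fun i => u i ≠ 0).card := by exact_mod_cast hc.le
        have h1 : 1 ≤ (a : ℝ)⁻¹ * ((Finset.univ.filter fun i => u i ≠ 0).card : ℝ) := by
          rw [inv_mul_eq_div, one_le_div hap]; exact hc'
        have h2 := mul_nonneg B0 E0
        rw [mul_assoc (2 / 3 : ℝ)]
        linarith
    rw [prodExp_const_mul, prodExp_add, prodExp_const_mul] at this
    have h2 : 2 / 3 * (a : ℝ)⁻¹ * prodExp s P N (fun u => ∑ i, if u i = 0 then (0 : ℝ) else 1) ≤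
        2 / 3 * (a : ℝ)⁻¹ * (6 * a * (1 / 200)) :=
      mul_le_mul_of_nonneg_left (hPE.trans (by linarith)) (by positivity)
    have h3 : 2 / 3 * (a : ℝ)⁻¹ * (6 * a * (1 / 200)) = 2 / 3 * (3 / 100) := by
      field_simp; norm_num
    have h4 : prodExp s P N (fun u => acceptMean l m q φ u) = prodExp s P N (acceptMean l m q φ) :=
      rfl
    linarith
  -- The small-support law accepts with mean at least `2/3 * (7/8 - 3/100) > 0.56`, whereas the
  -- comparison allows at most `1/3 + 1/20 + 1/40 < 0.41`.
  have hcmp := prodExp_acceptMean_le hP hQ hP1 hm hl hs hN m q φ hφ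
  linarith

/-- Every function of `q` samples that separates the distributions on `N` symbols with support at
most `a` from those with all probabilities at least `1 / (140 N)` has `q ≥ c N / log N`. -/
theorem support_size_test_lower_bound {q a : ℕ} (hN : 4 ≤ N) (hNa : N ≤ 6 * a)
    (φ : (Fin q → Fin N) → ℝ) (hφ : ∀ t, 0 ≤ φ t ∧ φ t ≤ 1)
    (hnear : ∀ p : Fin N → ℝ, (∀ i, 0 ≤ p i) → ∑ i, p i = 1 →
      (Finset.univ.filter fun i => p i ≠ 0).card ≤ a → 2 / 3 ≤ ∑ t, (∏ j, p (t j)) * φ t)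
    (hfar : ∀ p : Fin N → ℝ, ∑ i, p i = 1 → (∀ i, 1 / (140 * N) ≤ p i) →
      ∑ t, (∏ j, p (t j)) * φ t ≤ 1 / 3) :
    1 / 2000000 * (N / Real.log N) ≤ q := by
  have hN4 : (4 : ℝ) ≤ N := by exact_mod_cast hN
  have hNp : (0 : ℝ) < N := by linarith
  have : NeZero N := ⟨by omega⟩
  have hlog : 1 ≤ Real.log N := by
    rw [Real.le_log_iff_exp_le hNp]
    linarith [Real.exp_one_lt_d9]
  -- Without samples `φ` is a constant, and a point mass and the uniform distribution contradict
  -- each other. Later `q ≥ 1` gives `exp (-3q) ≤ exp (-3)`.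
  rcases Nat.eq_zero_or_pos q with rfl | hq
  · exfalso
    have h1 := hnear (fun i => if i = 0 then 1 else 0) (fun i => by split_ifs <;> norm_num)
      (by simp) (by simp [Finset.filter_eq']; omega)
    have h2 := hfar (fun _ => 1 / N) (by simp [(by positivity : (N : ℝ) ≠ 0)]) (fun i => by
      apply one_div_le_one_div_of_le hNp; linarith)
    simp at h1 h2
    linarith
  by_contra hlt
  push Not at hlt
  have hq1 : (1 : ℝ) ≤ q := by exact_mod_cast hq
  set J := ⌈Real.log N⌉₊ + 2 with hJ
  have hJ1 : Real.log N + 2 ≤ J := by rw [hJ]; push_cast; linarith [Nat.le_ceil (Real.log N)]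
  have hJ2 : (J : ℝ) ≤ 4 * Real.log N := by
    rw [hJ]; push_cast; linarith [Nat.ceil_lt_add_one (by linarith : 0 ≤ Real.log N)]
  have hJp : (0 : ℝ) < J := by linarith
  -- Then `7 m / N ≤ J + 2`, which is beaten by `8 ^ (-(J + 2)) ≤ exp (-2 (J + 2))`; as `J ≥ log N +
  -- 2`, the factor `N` is beaten too.
  set m := ⌊(N : ℝ) * (J + 2) / 8⌋₊ with hm
  have hm1 : (m : ℝ) ≤ N * (J + 2) / 8 := Nat.floor_le (by positivity)
  have hm2 : N * (J : ℝ) / 8 ≤ m := by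
    have := Nat.lt_floor_add_one ((N : ℝ) * (J + 2) / 8)
    rw [← hm] at this
    linarith
  refine no_support_size_test_aux (J := J) (m := m) (by omega) (by omega) hNa ?_ ?_ φ hφ hnear hfar
  · have e8 : Real.exp 2 ≤ 8 := by
      have : Real.exp 2 = Real.exp 1 ^ 2 := by rw [← Real.exp_nat_mul]; norm_num
      rw [this]
      nlinarith [Real.exp_one_lt_d9, Real.exp_pos 1]
    have h1 : (8 : ℝ)⁻¹ ^ (J + 2) ≤ Real.exp (-(2 * (J + 2))) := by
      have : (8 : ℝ)⁻¹ ≤ Real.exp (-2) := by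
        rw [Real.exp_neg]; exact inv_anti₀ (Real.exp_pos _) e8
      calc _ ≤ Real.exp (-2) ^ (J + 2) := pow_le_pow_left₀ (by norm_num) this _
        _ = _ := by rw [← Real.exp_nat_mul]; congr 1; push_cast; ring
    have h2 : 7 * (m : ℝ) / N ≤ J + 2 := by
      rw [div_le_iff₀ hNp]; nlinarith
    calc N * ((8 : ℝ)⁻¹ ^ (J + 2) * Real.exp (7 * m / N))
        ≤ Real.exp (Real.log N) * (Real.exp (-(2 * (J + 2))) * Real.exp (J + 2)) := by
          rw [Real.exp_log hNp]; gcongr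
      _ = Real.exp (Real.log N - J - 2) := by
          rw [← Real.exp_add, ← Real.exp_add]; congr 1; ring
      _ ≤ Real.exp (-4) := Real.exp_le_exp.2 (by linarith)
      _ ≤ 1 / 40 := by
          have h4 : Real.exp 4 = Real.exp 1 ^ 4 := by rw [← Real.exp_nat_mul]; norm_num
          have h5 : (2.7 : ℝ) ^ 4 ≤ Real.exp 1 ^ 4 :=
            pow_le_pow_left₀ (by norm_num) (by linarith [Real.exp_one_gt_d9]) 4
          rw [Real.exp_neg, one_div]
          refine inv_anti₀ (by norm_num) ?_
          rw [h4]; refine le_trans ?_ h5; norm_num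
  · have h1 : N / (256000 * Real.log N) ≤ m * (1 / (4000 * (J : ℝ) ^ 2)) / 2 := by
      calc N / (256000 * Real.log N) ≤ N / (64000 * J) := by
            apply div_le_div_of_nonneg_left hNp.le (by positivity) (by linarith)
        _ = N * (J : ℝ) / 8 * (1 / (4000 * (J : ℝ) ^ 2)) / 2 := by field_simp; norm_num
        _ ≤ _ := by gcongr
    have h2 : 4 * (q : ℝ) ≤ N / (256000 * Real.log N) := by
      have : (N : ℝ) / (256000 * Real.log N) = 2000000 / 256000 * (1 / 2000000 * (N / Real.log N)) := by
        field_simp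
      rw [this]; linarith
    have h3 : (2 : ℝ) ^ q ≤ Real.exp q := by
      calc (2 : ℝ) ^ q ≤ Real.exp 1 ^ q :=
            pow_le_pow_left₀ (by norm_num) (by linarith [Real.exp_one_gt_d9]) q
        _ = _ := by rw [← Real.exp_nat_mul, mul_one]
    calc _ ≤ Real.exp q * Real.exp (-(4 * q)) := by gcongr; linarith
      _ = Real.exp (-(3 * q)) := by rw [← Real.exp_add]; congr 1; ring
      _ ≤ Real.exp (-3) := Real.exp_le_exp.2 (by linarith)
      _ ≤ 1 / 10 := by
          have h4 : Real.exp 3 = Real.exp 1 ^ 3 := by rw [← Real.exp_nat_mul]; norm_num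
          have h5 : (2.7 : ℝ) ^ 3 ≤ Real.exp 1 ^ 3 :=
            pow_le_pow_left₀ (by norm_num) (by linarith [Real.exp_one_gt_d9]) 3
          rw [Real.exp_neg, one_div]
          refine inv_anti₀ (by norm_num) ?_
          rw [h4]; refine le_trans ?_ h5; norm_num

end Core

namespace PropertyTesting

/-! ### Halfspaces on the moment curve. -/

section MomentCurve

open Polynomial

/-- The point with parameter `t` on the moment curve. -/
def momentPoint (n : ℕ) (t : ℝ) : LebesgueSpace n :=
  (fun e : Fin n => t ^ (e.1 + 1) : Fin n → ℝ)

lemma momentPoint_injective {n : ℕ} (hn : 1 ≤ n) : Function.Injective (momentPoint n) := by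
  intro a b h
  have h' := congrFun (show (fun e : Fin n => a ^ (e.1 + 1)) = fun e : Fin n => b ^ (e.1 + 1) from h)
    ⟨0, hn⟩
  simpa using h'

lemma halfspace_momentPoint {n : ℕ} (w₀ : ℝ) (w : Fin n → ℝ) (t : ℝ) :
    halfspace w₀ w (momentPoint n t) = true ↔ 0 ≤ w₀ + ∑ i : Fin n, w i * t ^ (i.1 + 1) :=
  decide_eq_true_iff

lemma exists_polynomial_halfspace {n : ℕ} (w₀ : ℝ) (w : Fin n → ℝ) :
    ∃ P : ℝ[X], P.natDegree ≤ n ∧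
      ∀ t, (halfspace w₀ w (momentPoint n t) = true ↔ 0 ≤ P.eval t) := by
  refine ⟨C w₀ + ∑ i : Fin n, C (w i) * X ^ (i.1 + 1), ?_, fun t => ?_⟩
  · refine natDegree_add_le_of_degree_le (by simp) (natDegree_sum_le_of_forall_le _ _ fun i _ => ?_)
    exact (natDegree_C_mul_X_pow_le _ _).trans i.2
  · simp [halfspace_momentPoint, eval_finsetSum]

lemma exists_halfspace_of_polynomial {n : ℕ} (P : ℝ[X]) (hP : P.natDegree ≤ n) :
    ∃ (w₀ : ℝ) (w : Fin n → ℝ),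
      ∀ t, (halfspace w₀ w (momentPoint n t) = true ↔ 0 ≤ P.eval t) := by
  refine ⟨P.coeff 0, fun i => P.coeff (i.1 + 1), fun t => ?_⟩
  rw [eval_eq_sum_range' (Nat.lt_succ_of_le hP), Finset.sum_range_succ',
    Finset.sum_range fun i => P.coeff (i + 1) * t ^ (i + 1)]
  rw [halfspace_momentPoint]
  simp [add_comm]

/-- The parameter of the `b`-th point of the `i`-th pair. -/
def pairParam (i : ℕ) (b : Bool) : ℝ := 2 * i + if b then 1 else 0

lemma pairParam_injective : Function.Injective fun z : ℕ × Bool => pairParam z.1 z.2 := by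
  rintro ⟨i, b⟩ ⟨j, c⟩ h
  have h' : (2 * i + if b then 1 else 0 : ℕ) = 2 * j + if c then 1 else 0 := by
    have : ((2 * i + if b then 1 else 0 : ℕ) : ℝ) = (2 * j + if c then 1 else 0 : ℕ) := by
      push_cast
      exact h
    exact_mod_cast this
  cases b <;> cases c <;> simp at h' ⊢ <;> omega

/-- A change of sign on a pair forces a root in `[2i, 2i + 1]`. These intervals are disjoint, so the
roots are distinct. -/
lemma card_sign_changes_le {N n : ℕ} (P : ℝ[X]) (hP : P.natDegree ≤ n) :
    (Finset.univ.filter fun i : Fin N =>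
      ¬ (0 ≤ P.eval (pairParam i false) ↔ 0 ≤ P.eval (pairParam i true))).card ≤ n := by
  classical
  have hroot : ∀ i : Fin N, ¬ (0 ≤ P.eval (pairParam i false) ↔ 0 ≤ P.eval (pairParam i true)) →
      ∃ r : ℝ, (2 * i : ℝ) ≤ r ∧ r ≤ 2 * i + 1 ∧ P.eval r = 0 ∧ P ≠ 0 := by
    intro i hi
    have hP0 : P ≠ 0 := by rintro rfl; simp at hi
    have hle : pairParam i false ≤ pairParam i true := by simp [pairParam]
    have hc : ContinuousOn (fun t => P.eval t) (Set.Icc (pairParam i false) (pairParam i true)) :=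
      P.continuous.continuousOn
    have key : (0 : ℝ) ∈ (fun t => P.eval t) '' Set.Icc (pairParam i false) (pairParam i true) := by
      by_cases h : 0 ≤ P.eval (pairParam i false)
      · exact intermediate_value_Icc' hle hc ⟨(by by_contra h'; exact hi ⟨fun _ => by linarith,
          fun _ => h⟩), h⟩
      · push Not at h
        refine intermediate_value_Icc hle hc ⟨h.le, ?_⟩
        by_contra h'
        exact hi ⟨fun h'' => absurd h'' (not_le.2 h), fun h'' => absurd h'' h'⟩
    obtain ⟨r, ⟨hr1, hr2⟩, hr⟩ := key
    simp only [pairParam, if_true, Bool.false_eq_true, if_false, add_zero] at hr1 hr2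
    exact ⟨r, hr1, hr2, hr, hP0⟩
  choose! r hr1 hr2 hr0 hP0 using hroot
  refine le_trans (Finset.card_le_card_of_injOn r (t := P.roots.toFinset) ?_ ?_)
    ((Multiset.toFinset_card_le _).trans ((card_roots' P).trans hP))
  · intro i hi
    have hi' := (Finset.mem_filter.1 hi).2
    simp only [Finset.mem_coe, Multiset.mem_toFinset, mem_roots (hP0 i hi'), IsRoot.def]
    exact hr0 i hi'
  · intro i hi j hj hij
    have hi' := (Finset.mem_filter.1 hi).2
    have hj' := (Finset.mem_filter.1 hj).2
    have h1 : (2 * (i : ℕ) : ℝ) ≤ 2 * (j : ℕ) + 1 := by linarith [hr1 i hi', hr2 j hj']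
    have h2 : (2 * (j : ℕ) : ℝ) ≤ 2 * (i : ℕ) + 1 := by linarith [hr1 j hj', hr2 i hi']
    have h1' : 2 * (i : ℕ) ≤ 2 * (j : ℕ) + 1 := by exact_mod_cast h1
    have h2' : 2 * (j : ℕ) ≤ 2 * (i : ℕ) + 1 := by exact_mod_cast h2
    exact Fin.ext (by omega)

/-- An intersection of `k` halfspaces separates at most `n * k` of the pairs. -/
lemma card_separated_pairs_le {N n k : ℕ} {h : LebesgueSpace n → Bool}
    (hh : h ∈ halfspaceIntersections n k) :
    (Finset.univ.filter fun i : Fin N =>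
      h (momentPoint n (pairParam i false)) ≠ h (momentPoint n (pairParam i true))).card
      ≤ n * k := by
  classical
  obtain ⟨w₀, w, hw⟩ := hh
  choose P hP hPe using fun j : Fin k => exists_polynomial_halfspace (w₀ j) (w j)
  have hsub : (Finset.univ.filter fun i : Fin N =>
      h (momentPoint n (pairParam i false)) ≠ h (momentPoint n (pairParam i true))) ⊆
      Finset.univ.biUnion fun j : Fin k => Finset.univ.filter fun i : Fin N =>
        ¬ (0 ≤ (P j).eval (pairParam i false) ↔ 0 ≤ (P j).eval (pairParam i true)) := by
    intro i hi
    simp only [Finset.mem_filter, Finset.mem_univ, true_and, Finset.mem_biUnion] at hi ⊢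
    by_contra hcon
    push Not at hcon
    apply hi
    rw [Bool.eq_iff_iff, hw, hw]
    simp only [hPe]
    exact forall_congr' fun j => ⟨fun h' => by have := hcon j; grind, fun h' => by have := hcon j; grind⟩
  refine (Finset.card_le_card hsub).trans (Finset.card_biUnion_le.trans ?_)
  refine (Finset.sum_le_sum fun j _ => card_sign_changes_le (P j) (hP j)).trans ?_
  simp [mul_comm]

lemma exists_cover_card_le {α : Type*} [DecidableEq α] (r k : ℕ) (F : Finset α)
    (hF : F.card ≤ k * r) :
    ∃ A : Fin k → Finset α, (∀ j, (A j).card ≤ r) ∧ (∀ j, A j ⊆ F) ∧ ∀ x ∈ F, ∃ j, x ∈ A j := by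
  induction k generalizing F with
  | zero =>
    rw [zero_mul, Nat.le_zero, Finset.card_eq_zero] at hF
    exact ⟨Fin.elim0, fun j => j.elim0, fun j => j.elim0, by simp [hF]⟩
  | succ k ih =>
    obtain ⟨B, hB, hBc⟩ := Finset.exists_subset_card_eq (min_le_right r F.card)
    obtain ⟨A, hA1, hA2, hA3⟩ := ih (F \ B) (by
      rw [Finset.card_sdiff_of_subset hB, hBc]
      rw [add_mul, one_mul] at hF
      omega)
    refine ⟨Fin.cons B A, fun j => ?_, fun j => ?_, fun x hx => ?_⟩
    · refine Fin.cases ?_ (fun j => ?_) j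
      · simp only [Fin.cons_zero]; omega
      · simpa using hA1 j
    · refine Fin.cases ?_ (fun j => ?_) j
      · simpa using hB
      · simpa using (hA2 j).trans Finset.sdiff_subset
    · by_cases hxB : x ∈ B
      · exact ⟨0, by simpa using hxB⟩
      · obtain ⟨j, hj⟩ := hA3 x (Finset.mem_sdiff.2 ⟨hx, hxB⟩)
        exact ⟨j.succ, by simpa using hj⟩

lemma exists_pos_le_of_finset {α : Type*} (G : Finset α) (f : α → ℝ) (hf : ∀ g ∈ G, 0 < f g) :
    ∃ η : ℝ, 0 < η ∧ ∀ g ∈ G, η ≤ f g := by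
  classical
  induction G using Finset.induction_on with
  | empty => exact ⟨1, one_pos, by simp⟩
  | insert a G _ ih =>
    obtain ⟨η, h0, h1⟩ := ih fun g hg => hf g (Finset.mem_insert_of_mem hg)
    refine ⟨min η (f a), lt_min h0 (hf a (Finset.mem_insert_self _ _)), fun g hg => ?_⟩
    rcases Finset.mem_insert.1 hg with rfl | hg
    · exact min_le_right _ _
    · exact (min_le_left _ _).trans (h1 g hg)

/-- On a finite subset of the moment curve, any set of at most `k * (n / 2)` points can be cut off
by an intersection of `k` halfspaces. -/
lemma exists_halfspaceIntersection {n k : ℕ} (F G : Finset ℝ) (hFG : Disjoint F G)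
    (hF : F.card ≤ k * (n / 2)) :
    ∃ h ∈ halfspaceIntersections n k, (∀ t ∈ F, h (momentPoint n t) = false) ∧
      ∀ t ∈ G, h (momentPoint n t) = true := by
  classical
  obtain ⟨A, hA1, hA2, hA3⟩ := exists_cover_card_le (n / 2) k F hF
  have hpoly : ∀ j : Fin k, ∃ (w₀ : ℝ) (w : Fin n → ℝ),
      (∀ t ∈ A j, ¬ halfspace w₀ w (momentPoint n t) = true) ∧
      ∀ t ∈ G, halfspace w₀ w (momentPoint n t) = true := by
    intro j
    obtain ⟨η, hη0, hη⟩ := exists_pos_le_of_finset G (fun t => ∏ a ∈ A j, (t - a) ^ 2) (by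
      intro g hg
      refine Finset.prod_pos fun a ha => ?_
      have : g ≠ a := fun h => Finset.disjoint_left.1 hFG (hA2 j ha) (h ▸ hg)
      exact sq_pos_of_ne_zero (sub_ne_zero.2 this))
    -- The squared factors vanish on `A j` and are at least `η` on `G`; subtracting `η` makes the
    -- values on `A j` negative. The degree is at most `2 * (n / 2) ≤ n`.
    obtain ⟨w₀, w, hw⟩ := exists_halfspace_of_polynomial (n := n)
      (∏ a ∈ A j, (X - C a) ^ 2 - C η) (by
        refine (natDegree_sub_le _ _).trans (max_le ?_ (by simp))
        refine (natDegree_prod_le _ _).trans ?_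
        simp only [natDegree_pow, natDegree_X_sub_C]
        simp only [mul_one, Finset.sum_const, smul_eq_mul]
        have := hA1 j
        omega)
    refine ⟨w₀, w, fun t ht => ?_, fun t ht => ?_⟩
    · rw [hw]
      simp only [eval_sub, eval_prod, eval_pow, eval_X, eval_C]
      rw [Finset.prod_eq_zero ht (by simp)]
      linarith
    · rw [hw]
      simp only [eval_sub, eval_prod, eval_pow, eval_X, eval_C]
      linarith [hη t ht]
  choose w₀ w hw1 hw2 using hpoly
  refine ⟨fun x => decide (∀ j, halfspace (w₀ j) (w j) x = true), ⟨w₀, w, fun x => by simp⟩, ?_, ?_⟩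
  · intro t ht
    obtain ⟨j, hj⟩ := hA3 t ht
    exact decide_eq_false fun h => hw1 j t hj (h j)
  · intro t ht
    exact decide_eq_true fun j => hw2 j t ht

lemma measurable_of_mem_halfspaceIntersections {n k : ℕ} {h : LebesgueSpace n → Bool}
    (hh : h ∈ halfspaceIntersections n k) : Measurable h := by
  obtain ⟨w₀, w, hw⟩ := hh
  refine measurable_to_bool ?_
  have : h ⁻¹' {true} = ⋂ j, {x | halfspace (w₀ j) (w j) x = true} := by
    ext x
    simp only [Set.mem_preimage, Set.mem_singleton_iff, hw, Set.mem_iInter, Set.mem_ofPred_eq]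
  rw [this]
  refine MeasurableSet.iInter fun j => ?_
  have hm : MeasurableSet {x : Fin n → ℝ | 0 ≤ w₀ j + ∑ i, w j i * x i} :=
    measurableSet_le measurable_const (by fun_prop)
  have he : {x : LebesgueSpace n | halfspace (w₀ j) (w j) x = true} =
      {x : Fin n → ℝ | 0 ≤ w₀ j + ∑ i, w j i * x i} :=
    Set.ext fun x => decide_eq_true_iff
  rw [he]
  exact hm.nullMeasurableSet

end MomentCurve

end PropertyTesting

namespace PropertyTesting

/-! ### Atomic measures on pairs of points. -/

section Discrete

variable {X : Type*} [MeasurableSpace X]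

/-- The measure that gives the two points of the `i`-th pair mass `p i / 2` each. -/
noncomputable def pairMeasure {N : ℕ} (y : Fin N × Bool → X) (p : Fin N → ℝ) : Measure X :=
  ∑ z, ENNReal.ofReal (p z.1 / 2) • Measure.dirac (y z)

variable {N : ℕ} {y : Fin N × Bool → X} {p : Fin N → ℝ}

lemma le_pairMeasure (E : Set X) (A : Finset (Fin N × Bool)) (hA : ∀ z ∈ A, y z ∈ E) :
    ∑ z ∈ A, ENNReal.ofReal (p z.1 / 2) ≤ pairMeasure y p E := by
  rw [pairMeasure, Measure.finsetSum_apply]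
  refine le_trans (Finset.sum_le_sum fun z hz => ?_)
    (Finset.sum_le_sum_of_subset (Finset.subset_univ A))
  rw [Measure.smul_apply, Measure.dirac_apply_of_mem (hA z hz), smul_eq_mul, mul_one]

lemma pairMeasure_eq_zero [MeasurableSingletonClass X] (E : Set X)
    (hE : ∀ z, p z.1 ≠ 0 → y z ∉ E) : pairMeasure y p E = 0 := by
  rw [pairMeasure, Measure.finsetSum_apply]
  refine Finset.sum_eq_zero fun z _ => ?_
  rw [Measure.smul_apply, Measure.dirac_apply, smul_eq_mul]
  by_cases h : p z.1 = 0
  · simp [h]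
  · simp [hE z h]

lemma pairMeasure_singleton [MeasurableSingletonClass X] (hy : Function.Injective y)
    (z : Fin N × Bool) : pairMeasure y p {y z} = ENNReal.ofReal (p z.1 / 2) := by
  rw [pairMeasure, Measure.finsetSum_apply, Finset.sum_eq_single z]
  · simp
  · intro b _ hb
    simp [hy.ne hb]
  · simp

lemma sum_ofReal_half (hp0 : ∀ i, 0 ≤ p i) (hp1 : ∑ i, p i = 1) :
    ∑ z : Fin N × Bool, ENNReal.ofReal (p z.1 / 2) = 1 := by
  rw [← ENNReal.ofReal_sum_of_nonneg fun z _ => div_nonneg (hp0 _) (by norm_num),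
    Fintype.sum_prod_type]
  simp only [Fintype.sum_bool, add_halves, hp1, ENNReal.ofReal_one]

lemma isProbabilityMeasure_pairMeasure (hp0 : ∀ i, 0 ≤ p i) (hp1 : ∑ i, p i = 1) :
    IsProbabilityMeasure (pairMeasure y p) := by
  constructor
  rw [pairMeasure, Measure.finsetSum_apply]
  simpa using sum_ofReal_half hp0 hp1

variable [MeasurableSingletonClass X] {Ω : Type*} [MeasurableSpace Ω] {q : ℕ}

/-- Since the sample law is purely atomic, `E` agrees almost everywhere with a finite union of
rectangles over the atoms, so measurable sections in `ω` suffice. -/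
lemma prod_pi_pairMeasure_apply (hy : Function.Injective y) (hp0 : ∀ i, 0 ≤ p i)
    (hp1 : ∑ i, p i = 1) (μ : Measure Ω) [IsProbabilityMeasure μ] (E : Set (Ω × (Fin q → X)))
    (hE : ∀ s, MeasurableSet {ω | (ω, s) ∈ E}) :
    (μ.prod (Measure.pi fun _ : Fin q => pairMeasure y p)) E =
      ∑ t : Fin q → Fin N × Bool, μ {ω | (ω, fun j => y (t j)) ∈ E} *
        ∏ j, ENNReal.ofReal (p (t j).1 / 2) := by
  classical
  have := isProbabilityMeasure_pairMeasure (y := y) hp0 hp1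
  set ν := Measure.pi fun _ : Fin q => pairMeasure y p with hν
  set T : Set (Fin q → X) := {s | ∀ j, s j ∈ Set.range y} with hT
  have hTn : ∀ᵐ s ∂ν, s ∈ T := by
    rw [hT]
    refine ae_all_iff.2 fun j => ?_
    refine Measure.tendsto_eval_ae_ae.eventually ?_
    exact pairMeasure_eq_zero _ fun z _ h => h ⟨z, rfl⟩
  have hTn' : ∀ᵐ z ∂(μ.prod ν), z.2 ∈ T := Measure.quasiMeasurePreserving_snd.ae hTn
  set B : (Fin q → Fin N × Bool) → Set (Ω × (Fin q → X)) := fun t =>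
    {ω | (ω, fun j => y (t j)) ∈ E} ×ˢ {fun j => y (t j)} with hB
  have hcomp : Function.Injective fun (t : Fin q → Fin N × Bool) (j : Fin q) => y (t j) := by
    intro t t' h
    exact funext fun j => hy (congrFun h j)
  have hEB : E =ᵐ[μ.prod ν] ⋃ t ∈ (Finset.univ : Finset (Fin q → Fin N × Bool)), B t := by
    filter_upwards [hTn'] with z hz
    choose t ht using hz
    have ht' : (fun j => y (t j)) = z.2 := funext ht
    refine propext ?_
    change z ∈ E ↔ z ∈ ⋃ t ∈ (Finset.univ : Finset (Fin q → Fin N × Bool)), B t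
    simp only [Finset.mem_univ, Set.iUnion_true, Set.mem_iUnion, hB, Set.mem_prod,
      Set.mem_ofPred_eq, Set.mem_singleton_iff]
    constructor
    · intro hzE
      exact ⟨t, by rw [ht']; exact hzE, ht'.symm⟩
    · rintro ⟨t', h1, h2⟩
      rw [← h2] at h1
      exact h1
  rw [measure_congr hEB, measure_biUnion_finset]
  · refine Finset.sum_congr rfl fun t _ => ?_
    rw [hB, Measure.prod_prod, hν, Measure.pi_singleton]
    simp only [pairMeasure_singleton hy]
  · intro t _ t' _ htt'
    refine Set.disjoint_left.2 fun z h1 h2 => htt' (hcomp ?_)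
    exact (h1.2 : z.2 = _).symm.trans h2.2
  · exact fun t _ => (hE _).prod (measurableSet_singleton _)

/-- On the discrete measures `pairMeasure y p`, a randomized test of `q` sample points is given by
a function of `q` samples from `p`. -/
lemma exists_symbol_test (hy : Function.Injective y) (μ : Measure Ω) [IsProbabilityMeasure μ]
    (acc : Ω → (Fin q → X) → Bool) (hacc : ∀ s, Measurable fun ω => acc ω s) :
    ∃ φ : (Fin q → Fin N) → ℝ, (∀ t, 0 ≤ φ t ∧ φ t ≤ 1) ∧
      ∀ p : Fin N → ℝ, (∀ i, 0 ≤ p i) → ∑ i, p i = 1 →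
        ((μ.prod (Measure.pi fun _ : Fin q => pairMeasure y p)) {z | acc z.1 z.2 = true} =
          ENNReal.ofReal (∑ t, (∏ j, p (t j)) * φ t)) ∧
        ((μ.prod (Measure.pi fun _ : Fin q => pairMeasure y p)) {z | acc z.1 z.2 = true} +
          (μ.prod (Measure.pi fun _ : Fin q => pairMeasure y p)) {z | acc z.1 z.2 = false} = 1) := by
  have hms : ∀ (s : Fin q → X) (b : Bool), MeasurableSet {ω | acc ω s = b} := fun s b =>
    hacc s (measurableSet_singleton b)
  set g : (Fin q → Fin N × Bool) → ℝ := fun t =>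
    μ.real {ω | acc ω (fun j => y (t j)) = true} with hg
  have hg1 : ∀ t, 0 ≤ g t ∧ g t ≤ 1 := fun t => ⟨measureReal_nonneg, measureReal_le_one⟩
  -- Given its symbol, a sample is either point of the pair with probability `1 / 2`. Averaging over
  -- these bits gives a test that does not depend on `p`.
  refine ⟨fun s => ∑ b : Fin q → Bool, (1 / 2 : ℝ) ^ q * g (fun j => (s j, b j)),
    fun s => ⟨?_, ?_⟩, fun p hp0 hp1 => ⟨?_, ?_⟩⟩
  · exact Finset.sum_nonneg fun b _ => mul_nonneg (by positivity) (hg1 _).1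
  · calc _ ≤ ∑ _b : Fin q → Bool, (1 / 2 : ℝ) ^ q :=
          Finset.sum_le_sum fun b _ => mul_le_of_le_one_right (by positivity) (hg1 _).2
      _ = 1 := by
          simp only [Finset.sum_const, Finset.card_univ, Fintype.card_fun, Fintype.card_bool,
            Fintype.card_fin, nsmul_eq_mul]
          push_cast
          rw [← mul_pow]; norm_num
  · rw [prod_pi_pairMeasure_apply hy hp0 hp1 μ _ fun s => hms s true]
    have hterm : ∀ t : Fin q → Fin N × Bool,
        μ {ω | acc ω (fun j => y (t j)) = true} * ∏ j, ENNReal.ofReal (p (t j).1 / 2) =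
          ENNReal.ofReal (g t * ∏ j, (p (t j).1 / 2)) := by
      intro t
      rw [ENNReal.ofReal_mul (hg1 t).1,
        ENNReal.ofReal_prod_of_nonneg fun j _ => div_nonneg (hp0 _) (by norm_num), hg,
        ofReal_measureReal (measure_ne_top _ _)]
    simp only [Set.mem_ofPred_eq, hterm]
    rw [← ENNReal.ofReal_sum_of_nonneg fun t _ => mul_nonneg (hg1 t).1
      (Finset.prod_nonneg fun j _ => div_nonneg (hp0 _) (by norm_num))]
    congr 1
    rw [← (Equiv.arrowProdEquivProdArrow (Fin q) (fun _ => Fin N) (fun _ => Bool)).symm.sum_comp,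
      Fintype.sum_prod_type]
    refine Finset.sum_congr rfl fun s _ => ?_
    rw [Finset.mul_sum]
    refine Finset.sum_congr rfl fun b _ => ?_
    simp only [Equiv.arrowProdEquivProdArrow, Equiv.coe_fn_symm_mk, Finset.prod_div_distrib,
      Finset.prod_const, Finset.card_univ, Fintype.card_fin]
    rw [one_div, inv_pow]
    ring
  · rw [prod_pi_pairMeasure_apply hy hp0 hp1 μ _ fun s => hms s true,
      prod_pi_pairMeasure_apply hy hp0 hp1 μ _ fun s => hms s false, ← Finset.sum_add_distrib]
    have hsum := Fintype.sum_pow (fun z : Fin N × Bool => ENNReal.ofReal (p z.1 / 2)) q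
    rw [sum_ofReal_half hp0 hp1, one_pow] at hsum
    rw [hsum]
    refine Finset.sum_congr rfl fun t _ => ?_
    rw [← add_mul]
    have : μ {ω | acc ω (fun j => y (t j)) = true} + μ {ω | acc ω (fun j => y (t j)) = false} = 1 := by
      have hc : {ω | acc ω (fun j => y (t j)) = false} = {ω | acc ω (fun j => y (t j)) = true}ᶜ := by
        ext ω; simp
      rw [hc, measure_add_measure_compl (hms _ true), measure_univ]
    simp only [Set.mem_ofPred_eq]
    rw [this, one_mul]

end Discrete

/-! ### From testing halfspaces to testing support size. -/

section Reduction

/-- The points of the pairs on the moment curve. -/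
def pairPoint (n : ℕ) {N : ℕ} (z : Fin N × Bool) : LebesgueSpace n :=
  momentPoint n (pairParam z.1 z.2)

lemma pairPoint_injective {n N : ℕ} (hn : 1 ≤ n) : Function.Injective (pairPoint n (N := N)) := by
  intro z z' h
  have h' := pairParam_injective (a₁ := ((z.1 : ℕ), z.2)) (a₂ := ((z'.1 : ℕ), z'.2))
    (momentPoint_injective hn h)
  simp only [Prod.mk.injEq] at h'
  exact Prod.ext (Fin.ext h'.1) h'.2

open Classical in
/-- The function that is `true` exactly at the second points of the pairs. -/
noncomputable def pairLabel (n N : ℕ) (x : LebesgueSpace n) : Bool :=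
  decide (∃ i : Fin N, x = pairPoint n (i, true))

lemma pairLabel_eq_true_iff {n N : ℕ} {x : LebesgueSpace n} :
    pairLabel n N x = true ↔ ∃ i : Fin N, x = pairPoint n (i, true) := by
  classical
  simp [pairLabel]

lemma pairLabel_pairPoint {n N : ℕ} (hn : 1 ≤ n) (z : Fin N × Bool) :
    pairLabel n N (pairPoint n z) = z.2 := by
  obtain ⟨i, b⟩ := z
  cases b
  · refine Bool.eq_false_iff.2 fun h => ?_
    obtain ⟨j, hj⟩ := pairLabel_eq_true_iff.1 h
    simpa using pairPoint_injective hn hj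
  · exact pairLabel_eq_true_iff.2 ⟨i, rfl⟩

lemma measurable_pairLabel (n N : ℕ) : Measurable (pairLabel n N) := by
  refine measurable_to_bool ?_
  have : pairLabel n N ⁻¹' {true} = Set.range fun i : Fin N => pairPoint n (i, true) := by
    ext x
    simp only [Set.mem_preimage, Set.mem_singleton_iff, pairLabel_eq_true_iff, Set.mem_range]
    exact exists_congr fun i => eq_comm
  rw [this]
  exact (Set.finite_range _).measurableSet

lemma exists_agreeing_halfspaceIntersection {n N k : ℕ} (hn : 1 ≤ n) {p : Fin N → ℝ}
    (hp : (Finset.univ.filter fun i => p i ≠ 0).card ≤ k * (n / 2)) :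
    ∃ h ∈ halfspaceIntersections n k,
      pairMeasure (pairPoint n) p {x | pairLabel n N x ≠ h x} = 0 := by
  classical
  set A := Finset.univ.filter fun i => p i ≠ 0 with hA
  obtain ⟨h, hh, hF, hG⟩ := exists_halfspaceIntersection (n := n) (k := k)
    (A.image fun i : Fin N => pairParam i false)
    (A.image fun i : Fin N => pairParam i true) (by
      rw [Finset.disjoint_left]
      intro t h1 h2
      obtain ⟨i, _, rfl⟩ := Finset.mem_image.1 h1
      obtain ⟨j, _, hj⟩ := Finset.mem_image.1 h2
      have := pairParam_injective (a₁ := ((j : ℕ), true)) (a₂ := ((i : ℕ), false)) hj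
      simp at this) (Finset.card_image_le.trans hp)
  refine ⟨h, hh, pairMeasure_eq_zero _ fun z hz hne => hne ?_⟩
  rw [pairLabel_pairPoint hn]
  have hzA : z.1 ∈ A := by simpa [hA] using hz
  obtain ⟨i, b⟩ := z
  cases b
  · exact (hF _ (Finset.mem_image_of_mem (fun i : Fin N => pairParam i false) hzA)).symm
  · exact (hG _ (Finset.mem_image_of_mem (fun i : Fin N => pairParam i true) hzA)).symm

lemma le_distToClass_pairMeasure {n k : ℕ} (hn : 1 ≤ n) (hk : 1 ≤ k) {p : Fin (2 * (n * k)) → ℝ}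
    (hp : ∀ i, 1 / (140 * ((2 * (n * k) : ℕ) : ℝ)) ≤ p i) :
    ENNReal.ofReal (1 / 560) ≤ distToClass (pairMeasure (pairPoint n) p)
      (pairLabel n (2 * (n * k))) (halfspaceIntersections n k) := by
  classical
  refine le_iInf₂ fun h hh => ?_
  have hc := card_separated_pairs_le (N := 2 * (n * k)) hh
  set S := Finset.univ.filter fun i : Fin (2 * (n * k)) =>
      h (momentPoint n (pairParam i false)) ≠ h (momentPoint n (pairParam i true)) with hS
  have hcc : n * k ≤ Sᶜ.card := by
    rw [Finset.card_compl, Fintype.card_fin]; omega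
  have hsame : ∀ i ∈ Sᶜ, h (pairPoint n (i, false)) = h (pairPoint n (i, true)) := by
    intro i hi
    by_contra hne
    exact (Finset.mem_compl.1 hi) (Finset.mem_filter.2 ⟨Finset.mem_univ _, hne⟩)
  -- On an unseparated pair `h` is wrong at exactly one point, the one whose label is the negation
  -- of the common value. There are at least `nk` such points, each of mass at least `1 / (560 nk)`.
  set A : Finset (Fin (2 * (n * k)) × Bool) := Sᶜ.image fun i => (i, !h (pairPoint n (i, true)))
    with hA
  have hnk : (0 : ℝ) < n * k := by
    have h1 : (1 : ℝ) ≤ n := by exact_mod_cast hn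
    have h2 : (1 : ℝ) ≤ k := by exact_mod_cast hk
    nlinarith
  refine le_trans ?_ (le_pairMeasure _ A ?_)
  · rw [hA, Finset.sum_image (by intro i _ j _ hij; exact (Prod.ext_iff.1 hij).1)]
    calc ENNReal.ofReal (1 / 560)
        = ENNReal.ofReal ((n * k : ℕ) * (1 / (140 * ((2 * (n * k) : ℕ) : ℝ)) / 2)) := by
          congr 1; push_cast; field_simp; norm_num
      _ = ∑ _i ∈ Finset.range (n * k), ENNReal.ofReal (1 / (140 * ((2 * (n * k) : ℕ) : ℝ)) / 2) := by
          rw [ENNReal.ofReal_mul (by positivity), Finset.sum_const, Finset.card_range,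
            nsmul_eq_mul, ENNReal.ofReal_natCast]
      _ ≤ ∑ _i ∈ Sᶜ, ENNReal.ofReal (1 / (140 * ((2 * (n * k) : ℕ) : ℝ)) / 2) := by
          rw [Finset.sum_const, Finset.sum_const, Finset.card_range]
          exact nsmul_le_nsmul_left zero_le hcc
      _ ≤ _ := Finset.sum_le_sum fun i _ => ENNReal.ofReal_le_ofReal (by linarith [hp i])
  · intro z hz
    obtain ⟨i, hi, rfl⟩ := Finset.mem_image.1 hz
    change pairLabel _ _ _ ≠ _
    rw [pairLabel_pairPoint hn]
    have := hsame i hi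
    cases hb : h (pairPoint n (i, true)) <;> rw [hb] at this <;> simp [hb, this]

/-- The lower bound for any randomized test of `q` sample points that distinguishes the discrete
measures with small support on the moment curve from those that are spread out. -/
lemma test_lower_bound {n k q : ℕ} (hn : 2 ≤ n) (hk : 1 ≤ k) {Ω : Type*} [MeasurableSpace Ω]
    (μ : Measure Ω) [IsProbabilityMeasure μ] (acc : Ω → (Fin q → LebesgueSpace n) → Bool)
    (hacc : ∀ s, Measurable fun ω => acc ω s)
    (hnear : ∀ p : Fin (2 * (n * k)) → ℝ, IsProbabilityMeasure (pairMeasure (pairPoint n) p) →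
      (Finset.univ.filter fun i => p i ≠ 0).card ≤ k * (n / 2) →
      2 / 3 ≤ (μ.prod (Measure.pi fun _ : Fin q => pairMeasure (pairPoint n) p))
        {z | acc z.1 z.2 = true})
    (hfar : ∀ p : Fin (2 * (n * k)) → ℝ, IsProbabilityMeasure (pairMeasure (pairPoint n) p) →
      (∀ i, 1 / (140 * ((2 * (n * k) : ℕ) : ℝ)) ≤ p i) →
      2 / 3 ≤ (μ.prod (Measure.pi fun _ : Fin q => pairMeasure (pairPoint n) p))
        {z | acc z.1 z.2 = false}) :
    1 / 2000000 * ((n * k : ℝ) / Real.log (n * k)) ≤ q := by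
  obtain ⟨φ, hφ, hφp⟩ := exists_symbol_test (pairPoint_injective (N := 2 * (n * k)) (by omega : 1 ≤ n))
    μ acc hacc
  have hnk2 : 2 ≤ n * k := le_trans hn (Nat.le_mul_of_pos_right n hk)
  have e23 : (2 / 3 : ℝ≥0∞) = ENNReal.ofReal (2 / 3) := by
    rw [ENNReal.ofReal_div_of_pos (by norm_num)]; simp
  have key := support_size_test_lower_bound (N := 2 * (n * k)) (a := k * (n / 2)) (by omega) (by
    have : n ≤ 3 * (n / 2) := by omega
    calc 2 * (n * k) ≤ 2 * (3 * (n / 2) * k) := by gcongr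
      _ = _ := by ring) φ hφ (by
    intro p hp0 hp1 hpa
    have h := hnear p (isProbabilityMeasure_pairMeasure hp0 hp1) hpa
    rw [(hφp p hp0 hp1).1, e23] at h
    have h0 := (sum_prod_mul_le_one hp0 hp1 hφ).1
    exact (ENNReal.ofReal_le_ofReal_iff h0).1 h) (by
    intro p hp1 hpN
    have hp0 : ∀ i, 0 ≤ p i := fun i => le_trans (by positivity) (hpN i)
    have h := hfar p (isProbabilityMeasure_pairMeasure hp0 hp1) hpN
    have h1 := (hφp p hp0 hp1).2
    rw [(hφp p hp0 hp1).1] at h1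
    have h0 := (sum_prod_mul_le_one hp0 hp1 hφ).1
    have h2 : ENNReal.ofReal (∑ t, (∏ j, p (t j)) * φ t) + ENNReal.ofReal (2 / 3) ≤
        ENNReal.ofReal 1 := by
      rw [ENNReal.ofReal_one, ← h1, ← e23]
      exact add_le_add le_rfl h
    rw [← ENNReal.ofReal_add h0 (by norm_num), ENNReal.ofReal_le_ofReal_iff (by norm_num)] at h2
    linarith)
  refine le_trans ?_ key
  have hx : (2 : ℝ) ≤ n * k := by exact_mod_cast hnk2
  push_cast
  have hlog : 0 < Real.log ((n : ℝ) * k) := Real.log_pos (by linarith)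
  -- As `nk ≥ 2`, doubling the argument at most doubles the logarithm, so replacing `N = 2nk` by
  -- `nk` costs no constant.
  have hlog2 : Real.log (2 * ((n : ℝ) * k)) ≤ 2 * Real.log (n * k) := by
    rw [Real.log_mul (by norm_num) (by linarith)]
    have := Real.log_le_log (by norm_num) hx
    linarith
  have hlog3 : 0 < Real.log (2 * ((n : ℝ) * k)) := Real.log_pos (by linarith)
  refine mul_le_mul_of_nonneg_left ?_ (by norm_num)
  rw [div_le_div_iff₀ hlog hlog3]
  nlinarith

lemma QueryAlgorithm.measurable_transcript {X : Type*} [MeasurableSpace X] {q : ℕ}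
    (A : QueryAlgorithm X q) {f : X → Bool} (hf : Measurable f) (i : ℕ) (s : Fin i → X) :
    Measurable fun ω => A.transcript f ω i s := by
  induction i with
  | zero => exact measurable_const
  | succ i ih =>
    have hx : Measurable fun ω => Sum.elim (fun _ => s (Fin.last i)) id
        (A.next i ω (A.transcript f ω i (Fin.init s))) :=
      (Measurable.sumElim measurable_const measurable_id).comp
        ((A.measurable_next i).comp (measurable_id.prodMk (ih (Fin.init s))))
    refine measurable_pi_iff.2 fun j => ?_
    refine Fin.lastCases ?_ (fun j => ?_) j
    · simp only [QueryAlgorithm.transcript, Fin.snoc_last]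
      exact hx.prodMk (hf.comp hx)
    · simp only [QueryAlgorithm.transcript, Fin.snoc_castSucc]
      exact (measurable_pi_apply j).comp (ih (Fin.init s))

lemma natCast_lower_bound {r : ℝ} {x : ℕ∞} (h : (⌈r⌉₊ : ℕ∞) ≤ x) :
    ENNReal.ofReal r ≤ (x : ℝ≥0∞) := by
  refine le_trans ?_ (ENat.toENNReal_le.2 h)
  rw [ENat.toENNReal_coe, ← ENNReal.ofReal_natCast]
  exact ENNReal.ofReal_le_ofReal (Nat.le_ceil r)

/-- A tester must accept only genuine members of the class. For small support it is therefore
applied to an `h` in the class that agrees with `pairLabel` almost everywhere and hence yields the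
same labelled samples almost surely. -/
lemma SampleAlgorithm.IsTester.le {n k m : ℕ} (hn : 2 ≤ n) (hk : 1 ≤ k) {ε : ℝ}
    (hε : ε < 1 / 560) {A : SampleAlgorithm (LebesgueSpace n) m}
    (hA : A.IsTester (halfspaceIntersections n k) ε) :
    1 / 2000000 * ((n * k : ℝ) / Real.log (n * k)) ≤ m := by
  refine test_lower_bound hn hk A.seedLaw
    (fun ω s => A.output ω fun i => (s i, pairLabel n (2 * (n * k)) (s i)))
    (fun s => A.measurable_output.comp (measurable_id.prodMk measurable_const)) ?_ ?_
  · intro p hprob hpa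
    obtain ⟨h, hh, h0⟩ := exists_agreeing_halfspaceIntersection (k := k) (by omega : 1 ≤ n) hpa
    refine le_trans ((hA (pairMeasure (pairPoint n) p) h
      (measurable_of_mem_halfspaceIntersections hh)).1 hh) (le_of_eq (measure_congr ?_))
    have hae : ∀ᵐ s ∂(Measure.pi fun _ : Fin m => pairMeasure (pairPoint n) p),
        ∀ i, pairLabel n (2 * (n * k)) (s i) = h (s i) :=
      ae_all_iff.2 fun i => (Measure.tendsto_eval_ae_ae
        (μ := fun _ : Fin m => pairMeasure (pairPoint n) p) (i := i)).eventually (ae_iff.2 h0)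
    filter_upwards [Measure.quasiMeasurePreserving_snd.ae hae] with z hz
    refine propext ?_
    change A.output z.1 _ = true ↔ A.output z.1 _ = true
    simp only [hz]
  · intro p hprob hpN
    refine (hA (pairMeasure (pairPoint n) p) _ (measurable_pairLabel n _)).2 ?_
    refine lt_of_lt_of_le ?_ (le_distToClass_pairMeasure (by omega) hk hpN)
    exact (ENNReal.ofReal_lt_ofReal_iff (by norm_num)).2 hε

/-- Queries could tell `h` from `pairLabel` off the support, so the function stays `pairLabel`
throughout; tolerance at distance `0` still forces acceptance. The transcript then depends only on
the seed and the samples. -/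
lemma QueryAlgorithm.IsTolerantTester.le {n k q : ℕ} (hn : 2 ≤ n) (hk : 1 ≤ k) {ε : ℝ}
    (hε : ε < 1 / 560) {A : QueryAlgorithm (LebesgueSpace n) q}
    (hA : A.IsTolerantTester (halfspaceIntersections n k) 0 ε) :
    1 / 2000000 * ((n * k : ℝ) / Real.log (n * k)) ≤ q := by
  refine test_lower_bound hn hk A.seedLaw
    (fun ω s => A.output ω (A.transcript (pairLabel n (2 * (n * k))) ω q s))
    (fun s => A.measurable_output.comp
      (measurable_id.prodMk (A.measurable_transcript (measurable_pairLabel n _) q s))) ?_ ?_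
  · intro p hprob hpa
    obtain ⟨h, hh, h0⟩ := exists_agreeing_halfspaceIntersection (k := k) (by omega : 1 ≤ n) hpa
    refine (hA (pairMeasure (pairPoint n) p) _ (measurable_pairLabel n _)).1 ?_
    exact (iInf₂_le h hh).trans (h0.le.trans zero_le)
  · intro p hprob hpN
    refine (hA (pairMeasure (pairPoint n) p) _ (measurable_pairLabel n _)).2 ?_
    exact le_trans (ENNReal.ofReal_le_ofReal hε.le) (le_distToClass_pairMeasure (by omega) hk hpN)

end Reduction

end PropertyTesting

theorem mainTheorem3 :
    ∃ ε₀ c : ℝ, 0 < ε₀ ∧ 0 < c ∧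
      ∀ ε : ℝ, 0 < ε → ε < ε₀ → ∀ n k : ℕ, 2 ≤ n → 1 ≤ k →
        ENNReal.ofReal (c * ((n * k : ℝ) / Real.log (n * k))) ≤
            ((PropertyTesting.sampleComplexity
              (PropertyTesting.halfspaceIntersections n k) ε : ℕ∞) : ENNReal) ∧
        ENNReal.ofReal (c * ((n * k : ℝ) / Real.log (n * k))) ≤
            ((PropertyTesting.tolerantQueryComplexity
              (PropertyTesting.halfspaceIntersections n k) 0 ε : ℕ∞) : ENNReal) := by
  refine ⟨1 / 560, 1 / 2000000, by norm_num, by norm_num, fun ε _ hε n k hn hk => ⟨?_, ?_⟩⟩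
  · refine PropertyTesting.natCast_lower_bound (le_iInf₂ fun m hm => ?_)
    obtain ⟨A, hA⟩ := hm
    exact Nat.cast_le.2 (Nat.ceil_le.2 (hA.le hn hk hε))
  · refine PropertyTesting.natCast_lower_bound (le_iInf₂ fun q hq => ?_)
    obtain ⟨A, hA⟩ := hq
    exact Nat.cast_le.2 (Nat.ceil_le.2 (hA.le hn hk hε))
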